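/- Let $R$ be a commutative artinian ring and let $\Lambda$ be an artin $R$-algebra, that is, an $R$-algebra which is finitely generated as an $R$-module. Write $\mathrm{mod}(\Lambda)$ for the category of finitely generated left $\Lambda$-modules. For a family $\mathcal C$ of modules let $\mathcal F(\mathcal C)$ be the class of all modules $M$ that have a finite filtration $0=M_0\subseteq M_1\subseteq\cdots\subseteq M_s=M$ by submodules such that each $M_{k+1}/M_k$ is isomorphic to a member of $\mathcal C$. For a class $\mathcal X$ in $\mathrm{mod}(\Lambda)$ let ${}^{\perp_1}\mathcal X=\{M\in\mathrm{mod}(\Lambda):\mathrm{Ext}^1_\Lambda(M,X)=0\text{ for all }X\in\mathcal X\}$, and let $\mathrm{add}(M)$ be the class of direct summands of finite direct sums of copies of $M$. An Ext-projective stratifying system $(\Theta,\underline Q,\le)$ of size $t$ in $\mathrm{mod}(\Lambda)$ consists of two families $\Theta=\{\Theta(i)\}_{i=1}^t$ and $\underline Q=\{Q(i)\}_{i=1}^t$ of non-zero finitely generated $\Lambda$-modules, with every $Q(i)$ indecomposable, and a linear order $\le$ on $[1,t]=\{1,\dots,t\}$, such that - $\mathrm{Hom}_\Lambda(\Theta(i),\Theta(j))=0$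 whenever $i>j$; - for each $i$ there is an exact sequence $0\to K(i)\to Q(i)\to\Theta(i)\to0$ with $K(i)\in\mathcal F(\{\Theta(j):j>i\})$; - $\mathrm{Ext}^1_\Lambda(Q(i),\Theta(j))=0$ for all $i,j\in[1,t]$. Let $(\Theta,\underline Q,\le)$ be such a system, and put $Q=\bigoplus_{i=1}^tQ(i)$ and $\Gamma=\mathrm{End}_\Lambda(Q)^{op}$. Then $\Gamma$ is an artin $R$-algebra, and $F=\mathrm{Hom}_\Lambda(Q,-)$ and $G=Q\otimes_\Gamma-$ are functors $F:\mathrm{mod}(\Lambda)\to\mathrm{mod}(\Gamma)$ and $G:\mathrm{mod}(\Gamma)\to\mathrm{mod}(\Lambda)$. For $i\in[1,t]$ put ${}_\Gamma P(i)=F(Q(i))$ and $${}_\Gamma\Delta(i)={}_\Gamma P(i)\big/\mathrm{Tr}_{\bigoplus_{j>i}{}_\Gamma P(j)}\big({}_\Gamma P(i)\big),$$ where $\mathrm{Tr}_M(N)$ is the submodule of $N$ generated by the images of all homomorphisms $M\to N$; let ${}_\Gamma\Delta=\{{}_\Gamma\Delta(i)\}_{i=1}^t$. The following hold. (a) The family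 $\{F(Q(i)):i\in[1,t]\}$ is a representative set of the indecomposable projective $\Gamma$-modules: it contains exactly one module of each isomorphism class of these, and $F(Q(i))\not\simeq F(Q(j))$ for $i\ne j$. Moreover, $\Gamma$ is basic, that is, ${}_\Gamma\Gamma$ is a direct sum of pairwise non-isomorphic indecomposable modules, and the Grothendieck group $K_0(\Gamma)$ of $\mathrm{mod}(\Gamma)$ has rank $t$. (b) $(\Gamma,\le)$ is a standardly stratified algebra, that is, every finitely generated projective $\Gamma$-module lies in $\mathcal F({}_\Gamma\Delta)$. (c) $F$ restricts to an equivalence of categories $\mathcal F(\Theta)\to\mathcal F({}_\Gamma\Delta)$, which is exact (it carries short exact sequences with all terms in $\mathcal F(\Theta)$ to short exact sequences), and $G$ restricts to a functor $\mathcal F({}_\Gamma\Delta)\to\mathcal F(\Theta)$ which is a quasi-inverse of it. (d) $F(\Theta(i))\simeq{}_\Gamma\Delta(i)$ for all $i\in[1,t]$. (e) $\mathrm{add}(Q)=\mathcal F(\Theta)\cap{}^{\perp_1}\mathcal F(\Theta)$. -/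

import Mathlib

universe w u

open CategoryTheory
open scoped TensorProduct

noncomputable section

namespace StratSys

section Modules

variable {A : Type u} [Ring A]

/-- `X` has a finite filtration `0 = N 0 ⊆ N 1 ⊆ ⋯ ⊆ N s = X` by submodules, every factor
`N (k + 1) / N k` of which is isomorphic to some `C i` with `p i`. This is the class
`𝓕({C i : p i})`. -/
def FilteredBy {ι : Type} (C : ι → ModuleCat.{u} A) (p : ι → Prop) :
    ObjectProperty (ModuleCat.{u} A) := fun X =>
  ∃ (s : ℕ) (N : ℕ → Submodule A X), N 0 = ⊥ ∧ N s = ⊤ ∧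
    ∀ k, k < s → N k ≤ N (k + 1) ∧
      ∃ i, p i ∧ Nonempty ((↥(N (k + 1)) ⧸ (N k).submoduleOf (N (k + 1))) ≃ₗ[A] C i)

/-- The class `𝓕(C)` of modules filtered by the family `C`. -/
abbrev Filtered {ι : Type} (C : ι → ModuleCat.{u} A) : ObjectProperty (ModuleCat.{u} A) :=
  FilteredBy C (fun _ => True)

/-- `Ext¹_A(X, Y) = 0`. -/
def ExtOneVanishes (X Y : ModuleCat.{u} A) : Prop :=
  Subsingleton (Abelian.Ext.{u} X Y 1)

/-- The class of finitely generated `X` with `Ext¹(X, Y) = 0` for all `Y` in `C`. -/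
def LeftPerpOne (C : ObjectProperty (ModuleCat.{u} A)) : ObjectProperty (ModuleCat.{u} A) :=
  fun X => Module.Finite A X ∧ ∀ Y, C Y → ExtOneVanishes X Y

/-- `add M`: the direct summands of finite direct sums of copies of `M`. -/
def AddClosure (M : ModuleCat.{u} A) : ObjectProperty (ModuleCat.{u} A) := fun X =>
  ∃ (n : ℕ) (Y : ModuleCat.{u} A), Nonempty ((X × Y) ≃ₗ[A] (Fin n → M))

/-- The direct sum of a finite family of modules. -/
def finSum {ι : Type} [Finite ι] (M : ι → ModuleCat.{u} A) : ModuleCat.{u} A :=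
  ModuleCat.of A (∀ i, M i)

/-- The trace of `M` in `N`: the submodule generated by the images of all maps `M → N`. -/
def trace (M N : ModuleCat.{u} A) : Submodule A N :=
  ⨆ f : M →ₗ[A] N, LinearMap.range f

/-- The standard module `Δ(i) = P(i) / Tr_{⨁_{j > i} P(j)} P(i)`. -/
def standardModule {ι : Type} [Finite ι] [LinearOrder ι] (P : ι → ModuleCat.{u} A) (i : ι) :
    ModuleCat.{u} A :=
  ModuleCat.of A (P i ⧸ trace (finSum fun j : {j : ι // i < j} => P j) (P i))

variable (A) in
/-- The algebra `A` is basic: the left regular module is a direct sum of pairwise non-isomorphic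
indecomposable modules. -/
def IsBasic : Prop :=
  ∃ (n : ℕ) (P : Fin n → ModuleCat.{u} A), Nonempty (A ≃ₗ[A] ∀ i, P i) ∧
    (∀ i, Indecomposable (P i)) ∧ ∀ i j, Nonempty (P i ≅ P j) → i = j

/-- `P` contains exactly one module of each isomorphism class of (finitely generated)
indecomposable projective `A`-modules. -/
structure IsRepresentativeSet {ι : Type} (P : ι → ModuleCat.{u} A) : Prop where
  finite : ∀ i, Module.Finite A (P i)
  projective : ∀ i, Module.Projective A (P i)
  indecomposable : ∀ i, Indecomposable (P i)
  injective : ∀ i j, Nonempty (P i ≅ P j) → i = j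
  exhaustive : ∀ X : ModuleCat.{u} A, Module.Finite A X → Module.Projective A X →
    Indecomposable X → ∃ i, Nonempty (X ≅ P i)

/-- `A` is standardly stratified with respect to the linear order on the index set `ι` of the
representative set `P` of indecomposable projectives: `proj A ⊆ 𝓕(Δ)`. -/
structure IsStandardlyStratified {ι : Type} [Finite ι] [LinearOrder ι]
    (P : ι → ModuleCat.{u} A) : Prop where
  representative : IsRepresentativeSet P
  filtered : ∀ X : ModuleCat.{u} A, Module.Finite A X → Module.Projective A X →
    Filtered (standardModule P) X

variable (A) in
/-- The finitely generated `A`-modules, the generators of the Grothendieck group. -/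
abbrev FGMod : Type (u + 1) := {X : ModuleCat.{u} A // Module.Finite A X}

variable (A) in
/-- The elements `[Y] - [X] - [Z]` for short exact sequences `0 → X → Y → Z → 0` of finitely
generated modules. -/
def K0Relations : Set (FreeAbelianGroup (FGMod A)) :=
  {x | ∃ (X Y Z : FGMod A) (f : X.1 →ₗ[A] Y.1) (g : Y.1 →ₗ[A] Z.1),
    Function.Injective f ∧ Function.Exact f g ∧ Function.Surjective g ∧
    x = FreeAbelianGroup.of Y - FreeAbelianGroup.of X - FreeAbelianGroup.of Z}

variable (A) in
/-- The Grothendieck group of the category of finitely generated `A`-modules. -/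
abbrev K0 : Type (u + 1) :=
  FreeAbelianGroup (FGMod A) ⧸ AddSubgroup.closure (K0Relations A)

/-- An Ext-projective stratifying system `(Θ, Q, ≤)` in the category of finitely generated
`A`-modules, indexed by a finite linearly ordered set `ι`. -/
structure IsExtProjectiveStratifyingSystem {ι : Type} [Finite ι] [LinearOrder ι]
    (Θ Q : ι → ModuleCat.{u} A) : Prop where
  finite_theta : ∀ i, Module.Finite A (Θ i)
  finite_Q : ∀ i, Module.Finite A (Q i)
  nontrivial_theta : ∀ i, Nontrivial (Θ i)
  indecomposable_Q : ∀ i, Indecomposable (Q i)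
  hom_eq_zero : ∀ i j, j < i → ∀ f : Θ i →ₗ[A] Θ j, f = 0
  exists_sequence : ∀ i, ∃ (K : ModuleCat.{u} A) (α : K →ₗ[A] Q i) (β : Q i →ₗ[A] Θ i),
    Function.Injective α ∧ Function.Exact α β ∧ Function.Surjective β ∧
    FilteredBy Θ (fun j => i < j) K
  ext_vanishes : ∀ i j, ExtOneVanishes (Q i) (Θ j)

end Modules

section Functors

variable {Λ : Type u} [Ring Λ] (M : ModuleCat.{u} Λ)

/-- The opposite `End_Λ(M)ᵒᵖ` of the endomorphism ring of `M`. -/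
abbrev EndOp : Type u := (Module.End Λ M)ᵐᵒᵖ

/-- The structure of `R`-algebra on `End_Λ(M)ᵒᵖ`, for an `R`-algebra `Λ`. -/
@[reducible] def endOpAlgebra (R : Type w) [CommRing R] [Algebra R Λ] : Algebra R (EndOp M) :=
  letI : Module R M := Module.restrictScalars R Λ M
  haveI : IsScalarTower R Λ M := IsScalarTower.restrictScalars R Λ M
  inferInstance

/-- `Hom_Λ(M, X)` is a left `End_Λ(M)ᵒᵖ`-module by precomposition. -/
instance homModule (X : ModuleCat.{u} Λ) : Module (EndOp M) (M →ₗ[Λ] X) where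
  smul γ h := h ∘ₗ γ.unop
  one_smul _ := rfl
  mul_smul _ _ _ := rfl
  smul_zero _ := rfl
  smul_add _ _ _ := rfl
  add_smul γ γ' h := LinearMap.comp_add γ.unop γ'.unop h
  zero_smul h := LinearMap.comp_zero h

/-- The functor `F = Hom_Λ(M, -)` from `Λ`-modules to `End_Λ(M)ᵒᵖ`-modules. -/
def homFunctor : ModuleCat.{u} Λ ⥤ ModuleCat.{u} (EndOp M) where
  obj X := ModuleCat.of (EndOp M) (M →ₗ[Λ] X)
  map {_ _} f := ModuleCat.ofHom
    { toFun := fun h => f.hom ∘ₗ h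
      map_add' := fun h h' => LinearMap.comp_add h h' f.hom
      map_smul' := fun _ _ => rfl }
  map_id _ := rfl
  map_comp _ _ := rfl

instance : (homFunctor M).Additive where
  map_add {_ _ _ _} := rfl

/-- The submodule of `M ⊗_ℤ Y` generated by the elements `mγ ⊗ y - m ⊗ γy`, where
`γ ∈ End_Λ(M)ᵒᵖ` acts on `M` from the right by `mγ = γ(m)`. -/
def balancedRel (Y : ModuleCat.{u} (EndOp M)) : Submodule Λ (M ⊗[ℤ] Y) :=
  Submodule.span Λ {z | ∃ (m : M) (γ : EndOp M) (y : Y), z = γ.unop m ⊗ₜ[ℤ] y - m ⊗ₜ[ℤ] (γ • y)}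

/-- The map `M ⊗_ℤ Y → M ⊗_ℤ Y'` induced by `f : Y → Y'`. -/
def tensorMap {Y Y' : ModuleCat.{u} (EndOp M)} (f : Y ⟶ Y') :
    M ⊗[ℤ] Y →ₗ[Λ] M ⊗[ℤ] Y' :=
  TensorProduct.AlgebraTensorModule.map LinearMap.id f.hom.toAddMonoidHom.toIntLinearMap

lemma tensorMap_tmul {Y Y' : ModuleCat.{u} (EndOp M)} (f : Y ⟶ Y') (m : M) (y : Y) :
    tensorMap M f (m ⊗ₜ y) = m ⊗ₜ (f.hom y) := rfl

lemma balancedRel_le {Y Y' : ModuleCat.{u} (EndOp M)} (f : Y ⟶ Y') :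
    balancedRel M Y ≤ (balancedRel M Y').comap (tensorMap M f) := by
  refine Submodule.span_le.2 ?_
  rintro _ ⟨m, γ, y, rfl⟩
  refine Submodule.subset_span ⟨m, γ, f.hom y, ?_⟩
  rw [map_sub, tensorMap_tmul, tensorMap_tmul, map_smul]

/-- The functor `G = M ⊗_Γ -` from modules over `Γ = End_Λ(M)ᵒᵖ` to `Λ`-modules. -/
def tensorFunctor : ModuleCat.{u} (EndOp M) ⥤ ModuleCat.{u} Λ where
  obj Y := ModuleCat.of Λ ((M ⊗[ℤ] Y) ⧸ balancedRel M Y)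
  map {Y Y'} f := ModuleCat.ofHom
    (Submodule.mapQ (balancedRel M Y) (balancedRel M Y') (tensorMap M f) (balancedRel_le M f))
  map_id Y := by
    have h : tensorMap M (𝟙 Y) = LinearMap.id := by
      refine TensorProduct.AlgebraTensorModule.ext fun m y => rfl
    refine ModuleCat.hom_ext (Submodule.linearMap_qext _ (LinearMap.ext fun x => ?_))
    simp [h]
  map_comp {Y Y' Y''} f g := by
    have h : tensorMap M (f ≫ g) = tensorMap M g ∘ₗ tensorMap M f := by
      refine TensorProduct.AlgebraTensorModule.ext fun m y => rfl
    refine ModuleCat.hom_ext (Submodule.linearMap_qext _ (LinearMap.ext fun x => ?_))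
    simp [h]

end Functors

end StratSys

end

open StratSys

/-!
Write `T = ⨁ Q(i)`, `Γ = End(T)ᵒᵖ`, `F = Hom(T, -)` and `G = T ⊗_Γ -`. Since `Ext¹(Q(i), -)`
vanishes on `𝓕(Θ)`, the sequences `0 → K(i) → Q(i) → Θ(i) → 0` can be glued along a filtration by
the horseshoe lemma: every `X ∈ 𝓕(Θ)` has a cover `0 → Z → Y → X → 0` with `Y ∈ add T` and
`Z ∈ 𝓕(Θ)`. The cover splits when `Ext¹(X, -)` vanishes on `𝓕(Θ)`, which gives (e).

By the same vanishing, `F` is exact on short exact sequences whose first term is in `𝓕(Θ)`. The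
counit `G F → id` of the adjunction `G ⊣ F` is an isomorphism on `T`, hence on `add T`, hence on
`𝓕(Θ)` by the four lemma applied to the covers. So `F` is fully faithful on `𝓕(Θ)`; as
`Hom(Q(j), Θ(i)) = 0` for `j > i`, the image of `F K(i)` in `P(i) = F Q(i)` is exactly the trace of
the `P(j)` with `j > i`, and `F Θ(i) ≅ Δ(i)`. Applied to `0 → F K(i) → P(i) → Δ(i) → 0`, the functor
`G` gives back an exact sequence, so that `Tor₁(T, Δ(i)) = 0`. Therefore `G` is exact on sequences
ending in `Δ(i)`, and the unit `id → F G` is an isomorphism on `𝓕(Δ)` by the five lemma.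

The Krull–Schmidt property identifies the indecomposable projective `Γ`-modules with the `P(i)`.
Their tops generate `K₀(Γ)`, and the classes of the modules `F Θ(i)` are linearly independent: the
length of `Hom(P(i), F Θ(j))` over `End(P(i))ᵒᵖ`, which is additive in `F Θ(j)`, defines a
triangular matrix with non-zero diagonal entries.
-/

noncomputable section

namespace StratSys

/-! ### Short exact sequences -/

section ShortExact

variable {A : Type*} [Ring A] {X Y Z X' Y' Z' U V W : Type*} [AddCommGroup X] [Module A X]
  [AddCommGroup Y] [Module A Y] [AddCommGroup Z] [Module A Z] [AddCommGroup X'] [Module A X']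
  [AddCommGroup Y'] [Module A Y'] [AddCommGroup Z'] [Module A Z'] [AddCommGroup U] [Module A U]
  [AddCommGroup V] [Module A V] [AddCommGroup W] [Module A W]

/-- The sequence `0 → X → Y → Z → 0` of modules is exact. -/
structure IsShortExact (f : X →ₗ[A] Y) (g : Y →ₗ[A] Z) : Prop where
  injective : Function.Injective f
  exact : Function.Exact f g
  surjective : Function.Surjective g

namespace IsShortExact

lemma of_surjective {g : Y →ₗ[A] Z} (hg : Function.Surjective g) :
    IsShortExact (LinearMap.ker g).subtype g :=
  ⟨Submodule.injective_subtype _, g.exact_subtype_ker_map, hg⟩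

lemma inl_snd : IsShortExact (LinearMap.inl A X Y) (LinearMap.snd A X Y) :=
  ⟨LinearMap.inl_injective, .inl_snd, LinearMap.snd_surjective⟩

lemma zero_id : IsShortExact (0 : PUnit.{u + 1} →ₗ[A] X) LinearMap.id :=
  ⟨Function.injective_of_subsingleton _, fun x => by simp [eq_comm], Function.surjective_id⟩

lemma id_zero : IsShortExact LinearMap.id (0 : X →ₗ[A] PUnit.{u + 1}) :=
  ⟨Function.injective_id, fun x => by simp, fun _ => ⟨0, Subsingleton.elim _ _⟩⟩

lemma inclusion_mkQ {N N' : Submodule A X} (h : N ≤ N') :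
    IsShortExact (Submodule.inclusion h) (N.submoduleOf N').mkQ := by
  refine ⟨Submodule.inclusion_injective h, ?_, Submodule.mkQ_surjective _⟩
  rw [LinearMap.exact_iff, Submodule.ker_mkQ, Submodule.range_inclusion]
  rfl

variable {f : X →ₗ[A] Y} {g : Y →ₗ[A] Z}

lemma comp_equiv (h : IsShortExact f g) (e : Y' ≃ₗ[A] Y) (e' : Z ≃ₗ[A] Z') :
    IsShortExact (e.symm.toLinearMap ∘ₗ f) (e'.toLinearMap ∘ₗ g ∘ₗ e.toLinearMap) where
  injective := e.symm.injective.comp h.injective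
  exact y := by
    simp only [LinearMap.comp_apply, LinearEquiv.coe_coe, LinearEquiv.map_eq_zero_iff,
      h.exact (e y), Set.mem_range]
    exact exists_congr fun x => by rw [LinearEquiv.symm_apply_eq]
  surjective := e'.surjective.comp (h.surjective.comp e.surjective)

lemma bijective_of_subsingleton (h : IsShortExact f g) [Subsingleton Z] : Function.Bijective f :=
  ⟨h.injective, fun y => (h.exact y).1 (Subsingleton.elim _ _)⟩

lemma exists_comp_left_eq (h : IsShortExact f g) {φ : W →ₗ[A] Y} (hφ : g ∘ₗ φ = 0) :
    ∃ ψ : W →ₗ[A] X, f ∘ₗ ψ = φ :=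
  ⟨(LinearEquiv.ofInjective f h.injective).symm.toLinearMap ∘ₗ
      φ.codRestrict (LinearMap.range f) fun w => (h.exact _).1 (LinearMap.congr_fun hφ w),
    LinearMap.ext fun _ => congrArg Subtype.val
      ((LinearEquiv.ofInjective f h.injective).apply_symm_apply _)⟩

lemma exists_comp_right_eq (h : IsShortExact f g) {φ : Y →ₗ[A] W} (hφ : φ ∘ₗ f = 0) :
    ∃ ψ : Z →ₗ[A] W, ψ ∘ₗ g = φ := by
  have hker : LinearMap.ker g ≤ LinearMap.ker φ := by
    rw [h.exact.linearMap_ker_eq, LinearMap.range_le_ker_iff, hφ]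
  exact ⟨(LinearMap.ker g).liftQ φ hker ∘ₗ
    (g.quotKerEquivOfSurjective h.surjective).symm.toLinearMap, LinearMap.ext fun y => by simp⟩

lemma exists_of_columns (h : IsShortExact f g) {f' : X' →ₗ[A] Y'} {g' : Y' →ₗ[A] Z'}
    (hf' : Function.Injective f') (h' : Function.Exact f' g')
    {i₁ : U →ₗ[A] X} {i₂ : V →ₗ[A] Y} {i₃ : W →ₗ[A] Z}
    {a : X →ₗ[A] X'} {b : Y →ₗ[A] Y'} {c : Z →ₗ[A] Z'}
    (h₁ : IsShortExact i₁ a) (h₂ : IsShortExact i₂ b) (h₃ : IsShortExact i₃ c)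
    (hab : b ∘ₗ f = f' ∘ₗ a) (hbc : c ∘ₗ g = g' ∘ₗ b) :
    ∃ (k : U →ₗ[A] V) (l : V →ₗ[A] W), IsShortExact k l := by
  obtain ⟨k, hk⟩ := h₂.exists_comp_left_eq (φ := f ∘ₗ i₁) (by
    rw [← LinearMap.comp_assoc, hab, LinearMap.comp_assoc, h₁.exact.linearMap_comp_eq_zero,
      LinearMap.comp_zero])
  obtain ⟨l, hl⟩ := h₃.exists_comp_left_eq (φ := g ∘ₗ i₂) (by
    rw [← LinearMap.comp_assoc, hbc, LinearMap.comp_assoc, h₂.exact.linearMap_comp_eq_zero,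
      LinearMap.comp_zero])
  replace hk := LinearMap.congr_fun hk
  replace hl := LinearMap.congr_fun hl
  replace hab := LinearMap.congr_fun hab
  replace hbc := LinearMap.congr_fun hbc
  simp only [LinearMap.comp_apply] at hk hl hab hbc
  refine ⟨k, l, .of_comp (f := i₂) ?_, fun v => ⟨fun hv => ?_, ?_⟩, fun w => ?_⟩
  · rw [← LinearMap.coe_comp, show i₂ ∘ₗ k = f ∘ₗ i₁ from LinearMap.ext hk]
    exact h.injective.comp h₁.injective
  · obtain ⟨x, hx⟩ := (h.exact (i₂ v)).1 (by rw [← hl, hv, map_zero])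
    obtain ⟨u, rfl⟩ := (h₁.exact x).1
      (hf' (by rw [← hab, hx, h₂.exact.apply_apply_eq_zero, map_zero]))
    exact ⟨u, h₂.injective (by rw [hk, hx])⟩
  · rintro ⟨u, rfl⟩
    exact h₃.injective (by rw [hl, hk, h.exact.apply_apply_eq_zero, map_zero])
  · obtain ⟨y, hy⟩ := h.surjective (i₃ w)
    obtain ⟨x', hx'⟩ := (h' (b y)).1 (by rw [← hbc, hy, h₃.exact.apply_apply_eq_zero])
    obtain ⟨x, rfl⟩ := h₁.surjective x'
    obtain ⟨v, hv⟩ := (h₂.exact (y - f x)).1 (by rw [map_sub, hab, hx', sub_self])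
    exact ⟨v, h₃.injective (by
      rw [hl, hv, map_sub, hy, h.exact.apply_apply_eq_zero, sub_zero])⟩

lemma exists_horseshoe (h : IsShortExact f g) {i₁ : U →ₗ[A] X'} {a : X' →ₗ[A] X}
    (h₁ : IsShortExact i₁ a) {i₃ : W →ₗ[A] Z'} {c : Z' →ₗ[A] Z} (h₃ : IsShortExact i₃ c)
    {γ : Z' →ₗ[A] Y} (hγ : g ∘ₗ γ = c) :
    ∃ (b : X' × Z' →ₗ[A] Y) (k : U →ₗ[A] LinearMap.ker b) (l : LinearMap.ker b →ₗ[A] W),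
      Function.Surjective b ∧ IsShortExact k l := by
  let b : X' × Z' →ₗ[A] Y := (f ∘ₗ a).coprod γ
  have hbc (x : X' × Z') : g (b x) = c x.2 := by
    simp only [b, LinearMap.coprod_apply, LinearMap.comp_apply, map_add,
      h.exact.apply_apply_eq_zero, zero_add]
    exact LinearMap.congr_fun hγ x.2
  have hb : Function.Surjective b := fun y => by
    obtain ⟨z', hz'⟩ := h₃.surjective (g y)
    obtain ⟨x, hx⟩ := (h.exact (y - γ z')).1 (by
      rw [map_sub, ← hz', ← LinearMap.congr_fun hγ z', LinearMap.comp_apply, sub_self])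
    obtain ⟨x', rfl⟩ := h₁.surjective x
    exact ⟨(x', z'), by rw [LinearMap.coprod_apply, LinearMap.comp_apply, hx, sub_add_cancel]⟩
  obtain ⟨k, l, hkl⟩ := (inl_snd (A := A) (X := X') (Y := Z')).exists_of_columns h.injective
    h.exact h₁ (.of_surjective hb) h₃ (LinearMap.coprod_inl _ _)
    (LinearMap.ext fun x => (hbc x).symm)
  exact ⟨b, k, l, hb, hkl⟩

lemma exists_prod_neg_coprod (h : IsShortExact f g) {f' : X' →ₗ[A] Y'} {g' : Y' →ₗ[A] Z}
    (h' : IsShortExact f' g') {l : Y' →ₗ[A] Y} (hl : g ∘ₗ l = g') :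
    ∃ μ : X' →ₗ[A] X, IsShortExact (μ.prod (-f')) (f.coprod l) := by
  obtain ⟨μ, hμ⟩ := h.exists_comp_left_eq (φ := l ∘ₗ f') (by
    rw [← LinearMap.comp_assoc, hl, h'.exact.linearMap_comp_eq_zero])
  replace hμ := LinearMap.congr_fun hμ
  replace hl := LinearMap.congr_fun hl
  simp only [LinearMap.comp_apply] at hμ hl
  refine ⟨μ, fun x y hxy => h'.injective (neg_injective (congrArg Prod.snd hxy)), ?_, fun y => ?_⟩
  · refine fun ⟨x, y⟩ => ⟨fun hxy => ?_, ?_⟩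
    · rw [LinearMap.coprod_apply] at hxy
      obtain ⟨c, rfl⟩ := (h'.exact y).1 (by
        rw [← hl, ← map_zero g, ← hxy, map_add, h.exact.apply_apply_eq_zero, zero_add])
      refine ⟨-c, Prod.ext (h.injective ?_) ?_⟩
      · exact (hμ _).trans (by rw [map_neg, map_neg, eq_neg_of_add_eq_zero_left hxy])
      · exact (map_neg f' (-c)).symm.trans (by rw [neg_neg])
    · rintro ⟨c, hc⟩
      obtain ⟨rfl, rfl⟩ := Prod.ext_iff.1 hc
      exact (congrArg₂ (· + ·) (hμ c) (map_neg l (f' c))).trans (add_neg_cancel _)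
  · obtain ⟨y', hy'⟩ := h'.surjective (g y)
    obtain ⟨x, hx⟩ := (h.exact (y - l y')).1 (by rw [map_sub, hl, hy', sub_self])
    exact ⟨(x, y'), by rw [LinearMap.coprod_apply, hx, sub_add_cancel]⟩

end IsShortExact

end ShortExact

/-! ### Filtered modules -/

section Filtered

variable {A : Type u} [Ring A] {ι : Type} {C : ι → ModuleCat.{u} A} {p : ι → Prop}

lemma nonempty_quotient_submoduleOf_map_equiv {X Y : Type*} [AddCommGroup X] [Module A X]
    [AddCommGroup Y] [Module A Y] {f : X →ₗ[A] Y} (hf : Function.Injective f)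
    (N N' : Submodule A X) :
    Nonempty ((N'.map f ⧸ (N.map f).submoduleOf (N'.map f)) ≃ₗ[A] N' ⧸ N.submoduleOf N') := by
  let e : N' ≃ₗ[A] N'.map f := Submodule.equivMapOfInjective f hf N'
  have he : N.submoduleOf N' = ((N.map f).submoduleOf (N'.map f)).comap e.toLinearMap := by
    conv_lhs => rw [← Submodule.comap_map_eq_of_injective hf N]
    rfl
  exact ⟨(Submodule.Quotient.equiv _ _ e
    (by rw [he]; exact Submodule.map_comap_eq_of_surjective e.surjective _)).symm⟩

namespace FilteredBy

lemma of_subsingleton (X : ModuleCat.{u} A) [Subsingleton X] : FilteredBy C p X :=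
  ⟨0, fun _ => ⊥, rfl, Subsingleton.elim _ _, fun _ h => absurd h (Nat.not_lt_zero _)⟩

lemma extend {X' X : ModuleCat.{u} A} {i : ι} (hi : p i) {f : X' →ₗ[A] X} {g : X →ₗ[A] C i}
    (hfg : IsShortExact f g) (h : FilteredBy C p X') : FilteredBy C p X := by
  obtain ⟨s, N, h0, hs, hN⟩ := h
  let M : ℕ → Submodule A X := Function.update (fun k => (N k).map f) (s + 1) ⊤
  have hM : ∀ k ≤ s, M k = (N k).map f := fun k hk => Function.update_of_ne (by omega) ..
  have hM' : M (s + 1) = ⊤ := Function.update_self ..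
  refine ⟨s + 1, M, by rw [hM 0 s.zero_le, h0, Submodule.map_bot], hM', fun k hk => ?_⟩
  rcases Nat.lt_succ_iff_lt_or_eq.1 hk with hk | rfl
  · obtain ⟨hle, j, hj, ⟨e⟩⟩ := hN k hk
    rw [hM k hk.le, hM (k + 1) hk]
    obtain ⟨e'⟩ := nonempty_quotient_submoduleOf_map_equiv hfg.injective (N k) (N (k + 1))
    exact ⟨Submodule.map_mono hle, j, hj, ⟨e'.trans e⟩⟩
  · rw [hM k le_rfl, hM', hs, Submodule.map_top, ← hfg.exact.linearMap_ker_eq]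
    exact ⟨le_top, i, hi, ⟨(g ∘ₗ (⊤ : Submodule A X).subtype).quotKerEquivOfSurjective
      (hfg.surjective.comp fun x => ⟨⟨x, trivial⟩, rfl⟩)⟩⟩

@[elab_as_elim]
lemma induction {motive : ∀ X : ModuleCat.{u} A, FilteredBy C p X → Prop}
    (zero : ∀ (X : ModuleCat.{u} A) [Subsingleton X], motive X (of_subsingleton X))
    (step : ∀ {X' X : ModuleCat.{u} A} {i : ι} {f : X' →ₗ[A] X} {g : X →ₗ[A] C i} (hi : p i)
      (hfg : IsShortExact f g) (h : FilteredBy C p X'), motive X' h → motive X (h.extend hi hfg))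
    {X : ModuleCat.{u} A} (h : FilteredBy C p X) : motive X h := by
  obtain ⟨s, N, h0, hs, hN⟩ := h
  have key : ∀ k ≤ s, ∀ (Y : ModuleCat.{u} A) (_ : Y ≃ₗ[A] N k),
      ∃ h : FilteredBy C p Y, motive Y h := by
    intro k
    induction k with
    | zero =>
      intro _ Y e
      have : Subsingleton (N 0) := Submodule.subsingleton_iff_eq_bot.2 h0
      have : Subsingleton Y := e.injective.subsingleton
      exact ⟨_, zero Y⟩
    | succ k ih =>
      intro hk Y e
      obtain ⟨hle, i, hi, ⟨e'⟩⟩ := hN k hk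
      obtain ⟨_, hmotive⟩ := ih (Nat.le_of_succ_le hk) (ModuleCat.of A (N k)) (LinearEquiv.refl _ _)
      exact ⟨_, step hi ((IsShortExact.inclusion_mkQ hle).comp_equiv e e') _ hmotive⟩
  exact (key s le_rfl X (LinearEquiv.ofTop _ hs).symm).2

lemma of_equiv {X Y : ModuleCat.{u} A} (e : X ≃ₗ[A] Y) (h : FilteredBy C p X) :
    FilteredBy C p Y := by
  induction h using induction generalizing Y with
  | zero X =>
    have : Subsingleton Y := e.symm.injective.subsingleton
    exact of_subsingleton Y
  | step hi hfg h _ => exact h.extend hi (hfg.comp_equiv e.symm (LinearEquiv.refl A _))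

lemma of_isShortExact {X Y Z : ModuleCat.{u} A} {f : X →ₗ[A] Y} {g : Y →ₗ[A] Z}
    (hfg : IsShortExact f g) (hX : FilteredBy C p X) (hZ : FilteredBy C p Z) :
    FilteredBy C p Y := by
  induction hZ using induction generalizing Y with
  | zero Z => exact hX.of_equiv (.ofBijective f hfg.bijective_of_subsingleton)
  | @step Z' Z i k l hi hkl _ ih =>
    have hlg : IsShortExact (LinearMap.ker (l ∘ₗ g)).subtype (l ∘ₗ g) :=
      .of_surjective (hkl.surjective.comp hfg.surjective)
    obtain ⟨f', g', h'⟩ := hfg.exists_of_columns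
      (IsShortExact.zero_id (A := A) (X := C i)).injective
      IsShortExact.zero_id.exact IsShortExact.id_zero hlg hkl
      (by rw [LinearMap.comp_assoc, hfg.exact.linearMap_comp_eq_zero, LinearMap.comp_zero,
        LinearMap.zero_comp]) rfl
    exact (ih (Y := ModuleCat.of A (LinearMap.ker (l ∘ₗ g))) h').extend hi hlg

lemma single {i : ι} (hi : p i) : FilteredBy C p (C i) :=
  extend (X' := ModuleCat.of A PUnit) hi .zero_id (of_subsingleton _)

lemma prod {X Y : ModuleCat.{u} A} (hX : FilteredBy C p X) (hY : FilteredBy C p Y) :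
    FilteredBy C p (ModuleCat.of A (X × Y)) :=
  of_isShortExact (X := X) (Y := ModuleCat.of A (X × Y)) IsShortExact.inl_snd hX hY

lemma trans {κ : Type} {C' : κ → ModuleCat.{u} A} {q : κ → Prop}
    (hC : ∀ i, p i → FilteredBy C' q (C i)) {X : ModuleCat.{u} A} (h : FilteredBy C p X) :
    FilteredBy C' q X := by
  induction h using induction with
  | zero X => exact of_subsingleton X
  | step hi hfg _ ih => exact of_isShortExact hfg ih (hC _ hi)

lemma mono {q : ι → Prop} (hpq : ∀ i, p i → q i) {X : ModuleCat.{u} A} (h : FilteredBy C p X) :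
    FilteredBy C q X :=
  h.trans fun i hi => single (hpq i hi)

lemma hom_eq_zero {X Y : ModuleCat.{u} A} (hC : ∀ i, p i → ∀ f : C i →ₗ[A] Y, f = 0)
    (h : FilteredBy C p X) (φ : X →ₗ[A] Y) : φ = 0 := by
  induction h using induction with
  | zero X => exact Subsingleton.elim _ _
  | step hi hfg _ ih =>
    obtain ⟨ψ, rfl⟩ := hfg.exists_comp_right_eq (ih (φ ∘ₗ _))
    rw [hC _ hi ψ, LinearMap.zero_comp]

end FilteredBy

end Filtered

/-! ### Indecomposable modules -/

section Indecomposable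

variable {A : Type u} [Ring A] {X : ModuleCat.{u} A}

lemma nontrivial_of_indecomposable (h : Indecomposable X) : Nontrivial X :=
  not_subsingleton_iff_nontrivial.1 (ModuleCat.isZero_iff_subsingleton.not.1 h.1)

lemma eq_bot_or_eq_bot_of_isCompl (h : Indecomposable X) {N N' : Submodule A X}
    (hN : IsCompl N N') : N = ⊥ ∨ N' = ⊥ := by
  have e : X ≅ ModuleCat.of A N ⊞ ModuleCat.of A N' :=
    (Submodule.prodEquivOfIsCompl N N' hN).symm.toModuleIso ≪≫
      (ModuleCat.biprodIsoProd (ModuleCat.of A N) (ModuleCat.of A N')).symm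
  simpa only [ModuleCat.isZero_iff_subsingleton, ModuleCat.of_coe,
    Submodule.subsingleton_iff_eq_bot] using h.2 _ _ e

lemma eq_zero_or_eq_one_of_isIdempotentElem (h : Indecomposable X) {e : Module.End A X}
    (he : IsIdempotentElem e) : e = 0 ∨ e = 1 := by
  refine (eq_bot_or_eq_bot_of_isCompl h (LinearMap.IsIdempotentElem.isCompl he)).imp
    LinearMap.range_eq_bot.1 fun hker => ?_
  exact LinearMap.ext fun x => LinearMap.ker_eq_bot.1 hker (LinearMap.congr_fun he x)

lemma indecomposable_of_isIdempotentElem [Nontrivial X]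
    (h : ∀ e : Module.End A X, IsIdempotentElem e → e = 0 ∨ e = 1) : Indecomposable X := by
  refine ⟨by rwa [ModuleCat.isZero_iff_subsingleton, not_subsingleton_iff_nontrivial],
    fun Y Z i => ?_⟩
  let e : X ⟶ X := i.hom ≫ Limits.biprod.fst ≫ Limits.biprod.inl ≫ i.inv
  have he : e ≫ e = e := by simp [e]
  have hY : 𝟙 Y = Limits.biprod.inl ≫ i.inv ≫ e ≫ i.hom ≫ Limits.biprod.fst := by simp [e]
  have hZ : Limits.biprod.inr ≫ i.inv ≫ e ≫ i.hom ≫ Limits.biprod.snd = 0 := by simp [e]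
  rcases h e.hom (congrArg ModuleCat.Hom.hom he) with h0 | h1
  · have h0 : e = 0 := ModuleCat.hom_ext h0
    left
    simpa [h0, Limits.IsZero.iff_id_eq_zero] using hY
  · have h1 : e = 𝟙 X := ModuleCat.hom_ext h1
    right
    simpa [h1, Limits.IsZero.iff_id_eq_zero] using hZ

/- By Fitting's lemma every endomorphism is invertible or nilpotent. -/
lemma isLocalRing_end_of_indecomposable [IsArtinian A X] [IsNoetherian A X]
    (h : Indecomposable X) : IsLocalRing (Module.End A X) := by
  have := nontrivial_of_indecomposable h
  refine IsLocalRing.of_isUnit_or_isUnit_one_sub_self fun f => ?_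
  obtain ⟨n, hn, hn1⟩ := (f.eventually_isCompl_ker_pow_range_pow.and
    (Filter.eventually_ge_atTop 1)).exists
  refine (eq_bot_or_eq_bot_of_isCompl h hn).imp (fun hker => ?_) fun hrange =>
    IsNilpotent.isUnit_one_sub ⟨n, LinearMap.range_eq_bot.1 hrange⟩
  have hf : Function.Injective f := by
    refine Function.Injective.of_comp (f := ⇑(f ^ (n - 1))) ?_
    rw [← Module.End.coe_mul, ← pow_succ, Nat.sub_add_cancel hn1]
    exact LinearMap.ker_eq_bot.1 hker
  exact (Module.End.isUnit_iff f).2 (IsArtinian.bijective_of_injective_endomorphism f hf)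

@[elab_as_elim]
lemma isCompl_induction {motive : ModuleCat.{u} A → Prop}
    (subsingleton : ∀ (X : ModuleCat.{u} A) [Subsingleton X], motive X)
    (indecomposable : ∀ (X : ModuleCat.{u} A) [IsArtinian A X] [IsNoetherian A X],
      Indecomposable X → motive X)
    (isCompl : ∀ (X : ModuleCat.{u} A) (N N' : Submodule A X), IsCompl N N' →
      motive (ModuleCat.of A N) → motive (ModuleCat.of A N') → motive X)
    (X : ModuleCat.{u} A) [IsArtinian A X] [IsNoetherian A X] : motive X := by
  induction h : Module.length A X using WellFoundedLT.induction generalizing X with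
  | _ n ih =>
    subst h
    rcases subsingleton_or_nontrivial X with _ | _
    · exact subsingleton X
    by_cases hX : Indecomposable X
    · exact indecomposable X hX
    obtain ⟨e, he, he0, he1⟩ : ∃ e : Module.End A X, IsIdempotentElem e ∧ e ≠ 0 ∧ e ≠ 1 := by
      contrapose! hX
      exact indecomposable_of_isIdempotentElem fun e he => or_iff_not_imp_left.2 (hX e he)
    have hmotive (N : Submodule A X) (hN : N ≠ ⊤) : motive (ModuleCat.of A N) :=
      have : IsArtinian A (ModuleCat.of A N) := inferInstanceAs (IsArtinian A N)
      have : IsNoetherian A (ModuleCat.of A N) := inferInstanceAs (IsNoetherian A N)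
      ih _ (Submodule.length_lt hN) (ModuleCat.of A N) rfl
    have hcompl := LinearMap.IsIdempotentElem.isCompl he
    refine isCompl X _ _ hcompl (hmotive _ fun hrange => he1 ?_)
      (hmotive _ fun hker => he0 (LinearMap.ker_eq_top.1 hker))
    have hker : LinearMap.ker e = ⊥ := eq_bot_of_top_isCompl (hrange ▸ hcompl)
    exact LinearMap.ext fun x => LinearMap.ker_eq_bot.1 hker (LinearMap.congr_fun he x)

end Indecomposable

/-! ### Additive closures -/

section MemAdd

variable {A : Type u} [Ring A] {ι : Type*} {M : ι → ModuleCat.{u} A} {X Y Z : ModuleCat.{u} A}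

variable (M X Y) in
/-- The maps `X → Y` which factor through a finite direct sum of members of the family `M`,
encoded as the sums of maps that factor through a single member. -/
def mapsThrough : AddSubgroup (X →ₗ[A] Y) :=
  AddSubgroup.closure {h | ∃ (i : ι) (f : X →ₗ[A] M i) (g : M i →ₗ[A] Y), g ∘ₗ f = h}

lemma comp_mem_mapsThrough {i : ι} (f : X →ₗ[A] M i) (g : M i →ₗ[A] Y) :
    g ∘ₗ f ∈ mapsThrough M X Y :=
  AddSubgroup.subset_closure ⟨i, f, g, rfl⟩

lemma mapsThrough_le {H : AddSubgroup (X →ₗ[A] Y)}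
    (h : ∀ (i : ι) (f : X →ₗ[A] M i) (g : M i →ₗ[A] Y), g ∘ₗ f ∈ H) : mapsThrough M X Y ≤ H := by
  refine (AddSubgroup.closure_le _).2 ?_
  rintro _ ⟨i, f, g, rfl⟩
  exact h i f g

lemma comp_mem_mapsThrough_of_right {f : X →ₗ[A] Y} (hf : f ∈ mapsThrough M X Y)
    (g : Y →ₗ[A] Z) : g ∘ₗ f ∈ mapsThrough M X Z :=
  mapsThrough_le (H := (mapsThrough M X Z).comap
      (LinearMap.compRight ℤ g : (X →ₗ[A] Y) →ₗ[ℤ] X →ₗ[A] Z).toAddMonoidHom)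
    (fun _ a b => comp_mem_mapsThrough a (g ∘ₗ b)) hf

lemma comp_mem_mapsThrough_of_left (f : X →ₗ[A] Y) {g : Y →ₗ[A] Z}
    (hg : g ∈ mapsThrough M Y Z) : g ∘ₗ f ∈ mapsThrough M X Z :=
  mapsThrough_le (H := (mapsThrough M X Z).comap (LinearMap.lcomp ℤ Z f).toAddMonoidHom)
    (fun _ a b => comp_mem_mapsThrough (a ∘ₗ f) b) hg

variable (M) in
/-- The additive closure `add {M i}` of a family of modules, encoded by the requirement that the
identity factors through a finite direct sum of members of the family. -/
def MemAdd : ObjectProperty (ModuleCat.{u} A) := fun X => LinearMap.id ∈ mapsThrough M X X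

namespace MemAdd

lemma comp_mem_mapsThrough (hY : MemAdd M Y) (f : X →ₗ[A] Y) (g : Y →ₗ[A] Z) :
    g ∘ₗ f ∈ mapsThrough M X Z :=
  comp_mem_mapsThrough_of_left f (comp_mem_mapsThrough_of_right hY g)

lemma of_retract (s : X →ₗ[A] Y) (r : Y →ₗ[A] X) (h : r ∘ₗ s = LinearMap.id)
    (hY : MemAdd M Y) : MemAdd M X := by
  rw [MemAdd, ← h]
  exact hY.comp_mem_mapsThrough s r

lemma of_equiv (e : X ≃ₗ[A] Y) (h : MemAdd M X) : MemAdd M Y :=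
  h.of_retract e.symm.toLinearMap e.toLinearMap (LinearMap.ext e.apply_symm_apply)

lemma self (i : ι) : MemAdd M (M i) :=
  StratSys.comp_mem_mapsThrough (i := i) LinearMap.id LinearMap.id

lemma of_subsingleton (X : ModuleCat.{u} A) [Subsingleton X] : MemAdd M X := by
  rw [MemAdd, Subsingleton.elim (LinearMap.id : X →ₗ[A] X) 0]
  exact zero_mem _

lemma finSum {κ : Type} [Finite κ] {N : κ → ModuleCat.{u} A} (h : ∀ k, MemAdd M (N k)) :
    MemAdd M (finSum N) := by
  classical
  have := Fintype.ofFinite κ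
  have hid : (LinearMap.id : (∀ k, N k) →ₗ[A] ∀ k, N k) =
      ∑ k, LinearMap.single A (fun k => N k) k ∘ₗ LinearMap.proj k := by
    ext k x j
    simp
  change (LinearMap.id : (∀ k, N k) →ₗ[A] ∀ k, N k) ∈
    mapsThrough M (StratSys.finSum N) (StratSys.finSum N)
  rw [hid]
  exact sum_mem fun k _ => (h k).comp_mem_mapsThrough (X := StratSys.finSum N)
    (Z := StratSys.finSum N) _ _

lemma prod (hX : MemAdd M X) (hY : MemAdd M Y) : MemAdd M (ModuleCat.of A (X × Y)) := by
  have hid : LinearMap.id = LinearMap.inl A X Y ∘ₗ LinearMap.fst A X Y +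
      LinearMap.inr A X Y ∘ₗ LinearMap.snd A X Y := LinearMap.coprod_inl_inr.symm
  change (LinearMap.id : X × Y →ₗ[A] X × Y) ∈
    mapsThrough M (ModuleCat.of A (X × Y)) (ModuleCat.of A (X × Y))
  rw [hid]
  exact add_mem
    (hX.comp_mem_mapsThrough (X := ModuleCat.of A (X × Y)) (Z := ModuleCat.of A (X × Y)) _ _)
    (hY.comp_mem_mapsThrough (X := ModuleCat.of A (X × Y)) (Z := ModuleCat.of A (X × Y)) _ _)

lemma trans {κ : Type*} {N : κ → ModuleCat.{u} A} (hM : ∀ i, MemAdd N (M i))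
    (hX : MemAdd M X) : MemAdd N X :=
  mapsThrough_le (fun i f g => (hM i).comp_mem_mapsThrough f g) hX

lemma of_comp {κ : Type*} {e : κ → ι} (h : MemAdd (fun k => M (e k)) X) : MemAdd M X :=
  trans (M := fun k => M (e k)) (fun k => self (e k)) h

lemma map {B : Type u} [Ring B] (F : ModuleCat.{u} A ⥤ ModuleCat.{u} B) [F.Additive]
    (h : MemAdd M X) : MemAdd (fun i => F.obj (M i)) (F.obj X) := by
  let H : AddSubgroup (X →ₗ[A] X) :=
    ((mapsThrough (fun i => F.obj (M i)) (F.obj X) (F.obj X)).comap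
      (ModuleCat.homAddEquiv.toAddMonoidHom.comp F.mapAddHom)).comap
        ModuleCat.homAddEquiv.symm.toAddMonoidHom
  have hid : LinearMap.id ∈ H := mapsThrough_le (fun i f g => by
    change (F.map (ModuleCat.ofHom f ≫ ModuleCat.ofHom g)).hom ∈
      mapsThrough (fun i => F.obj (M i)) (F.obj X) (F.obj X)
    rw [F.map_comp]
    exact StratSys.comp_mem_mapsThrough _ _) h
  change (F.map (𝟙 X)).hom ∈ mapsThrough (fun i => F.obj (M i)) (F.obj X) (F.obj X) at hid
  rwa [F.map_id] at hid

lemma isIso_app {D : Type*} [Category* D] [Preadditive D] {F G : ModuleCat.{u} A ⥤ D}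
    [F.Additive] [G.Additive] (α : F ⟶ G) [hα : ∀ i, IsIso (α.app (M i))] (h : MemAdd M X) :
    IsIso (α.app X) := by
  suffices ∀ a ∈ mapsThrough M X X, ∃ β : G.obj X ⟶ F.obj X,
      α.app X ≫ β = F.map (ModuleCat.ofHom a) ∧ β ≫ α.app X = G.map (ModuleCat.ofHom a) by
    obtain ⟨β, hαβ, hβα⟩ := this _ h
    exact ⟨β, hαβ.trans (F.map_id X), hβα.trans (G.map_id X)⟩
  intro a ha
  induction ha using AddSubgroup.closure_induction with
  | mem a ha =>
    obtain ⟨i, f, g, rfl⟩ := ha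
    refine ⟨G.map (ModuleCat.ofHom f) ≫ inv (α.app (M i)) ≫ F.map (ModuleCat.ofHom g), ?_, ?_⟩
    · simp [← α.naturality_assoc]
    · simp
  | zero => exact ⟨0, by simp, by simp⟩
  | add a b _ _ ha hb =>
    obtain ⟨β, hβ, hβ'⟩ := ha
    obtain ⟨γ, hγ, hγ'⟩ := hb
    exact ⟨β + γ, by simp [hβ, hγ, F.map_add], by simp [hβ', hγ', G.map_add]⟩
  | neg a _ ha =>
    obtain ⟨β, hβ, hβ'⟩ := ha
    exact ⟨-β, by rw [Preadditive.comp_neg, hβ, ← F.map_neg]; rfl,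
      by rw [Preadditive.neg_comp, hβ', ← G.map_neg]; rfl⟩

end MemAdd

lemma exists_isUnit_comp_of_memAdd [IsLocalRing (Module.End A X)] (h : MemAdd M X) :
    ∃ (i : ι) (f : X →ₗ[A] M i) (g : M i →ₗ[A] X), IsUnit (show Module.End A X from g ∘ₗ f) := by
  by_contra! hne
  let H : AddSubgroup (Module.End A X) :=
    { carrier := nonunits _
      zero_mem' := not_isUnit_zero
      add_mem' := IsLocalRing.nonunits_add
      neg_mem' := fun ha hn => ha ((IsUnit.neg_iff _).1 hn) }
  exact mapsThrough_le (H := H) hne h isUnit_one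

lemma bijective_of_comp_eq_id [Nontrivial X] (hY : Indecomposable Y) {s : X →ₗ[A] Y}
    {r : Y →ₗ[A] X} (h : r ∘ₗ s = LinearMap.id) : Function.Bijective s := by
  have hrs : Function.LeftInverse r s := LinearMap.congr_fun h
  have he : IsIdempotentElem (show Module.End A Y from s ∘ₗ r) :=
    LinearMap.ext fun y => congrArg s (hrs (r y))
  rcases eq_zero_or_eq_one_of_isIdempotentElem hY he with h0 | h1
  · obtain ⟨x, hx⟩ := exists_ne (0 : X)
    refine absurd (hrs.injective ?_) hx
    rw [map_zero, ← hrs x]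
    exact LinearMap.congr_fun h0 (s x)
  · exact ⟨hrs.injective, Function.RightInverse.surjective (LinearMap.congr_fun h1)⟩

lemma exists_equiv_of_memAdd (hM : ∀ i, Indecomposable (M i)) [IsArtinian A X] [IsNoetherian A X]
    (hX : Indecomposable X) (h : MemAdd M X) : ∃ i, Nonempty (X ≃ₗ[A] M i) := by
  have := isLocalRing_end_of_indecomposable hX
  have := nontrivial_of_indecomposable hX
  obtain ⟨i, f, g, hgf⟩ := exists_isUnit_comp_of_memAdd h
  obtain ⟨v, hv⟩ := hgf.exists_left_inv
  exact ⟨i, ⟨.ofBijective f (bijective_of_comp_eq_id (hM i) (r := v ∘ₗ g) hv)⟩⟩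

lemma FilteredBy.of_memAdd {κ : Type} {C : κ → ModuleCat.{u} A} {p : κ → Prop}
    (hM : ∀ i, Indecomposable (M i)) (hC : ∀ i, FilteredBy C p (M i)) [IsArtinian A X]
    [IsNoetherian A X] (h : MemAdd M X) : FilteredBy C p X := by
  revert h
  refine isCompl_induction (fun X _ _ => .of_subsingleton X) (fun X _ _ hX h => ?_)
    (fun X N N' hN ih ih' h => ?_) X
  · obtain ⟨i, ⟨e⟩⟩ := exists_equiv_of_memAdd hM hX h
    exact (hC i).of_equiv e.symm
  · have hadd {N N' : Submodule A X} (hN : IsCompl N N') : MemAdd M (ModuleCat.of A N) :=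
      h.of_retract (X := ModuleCat.of A N) N.subtype (N.projectionOnto N' hN)
        (LinearMap.ext (Submodule.projectionOnto_apply_left hN))
    exact ((ih (hadd hN)).prod (ih' (hadd hN.symm))).of_equiv (N.prodEquivOfIsCompl N' hN)

lemma exists_comp_eq_of_mem_mapsThrough {T : ModuleCat.{u} A} {a : X →ₗ[A] Y}
    (ha : a ∈ mapsThrough (fun _ : Unit => T) X Y) :
    ∃ (n : ℕ) (f : X →ₗ[A] (Fin n → T)) (g : (Fin n → T) →ₗ[A] Y), g ∘ₗ f = a := by
  suffices ∃ (n : ℕ) (f : Fin n → (X →ₗ[A] T)) (g : Fin n → (T →ₗ[A] Y)),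
      ∑ k, g k ∘ₗ f k = a by
    obtain ⟨n, f, g, rfl⟩ := this
    exact ⟨n, LinearMap.pi f, ∑ k, g k ∘ₗ LinearMap.proj k, by ext; simp⟩
  induction ha using AddSubgroup.closure_induction with
  | mem a ha =>
    obtain ⟨-, f, g, rfl⟩ := ha
    exact ⟨1, fun _ => f, fun _ => g, by simp⟩
  | zero => exact ⟨0, 0, 0, by simp⟩
  | add a b _ _ ha hb =>
    obtain ⟨n, f, g, rfl⟩ := ha
    obtain ⟨m, f', g', rfl⟩ := hb
    exact ⟨n + m, Fin.append f f', Fin.append g g', by simp [Fin.sum_univ_add]⟩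
  | neg a _ ha =>
    obtain ⟨n, f, g, rfl⟩ := ha
    exact ⟨n, f, -g, by simp [LinearMap.neg_comp]⟩

lemma addClosure_iff_memAdd {T : ModuleCat.{u} A} :
    AddClosure T X ↔ MemAdd (fun _ : Unit => T) X := by
  constructor
  · rintro ⟨n, Y, ⟨e⟩⟩
    refine (MemAdd.finSum fun _ : Fin n => .self (M := fun _ : Unit => T) ()).of_retract
      (e.toLinearMap ∘ₗ LinearMap.inl A X Y) (LinearMap.fst A X Y ∘ₗ e.symm.toLinearMap) ?_
    ext x
    exact congrArg Prod.fst (e.symm_apply_apply (x, 0))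
  · intro h
    obtain ⟨n, s, r, hrs⟩ := exists_comp_eq_of_mem_mapsThrough h
    exact ⟨n, ModuleCat.of A (LinearMap.ker r), ⟨(LinearEquiv.prodComm A X _).trans
      (lequivProdOfRightSplitExact (LinearMap.ker r).injective_subtype
        (Submodule.range_subtype _) hrs)⟩⟩

lemma AddClosure.finite {T : ModuleCat.{u} A} [Module.Finite A T] (h : AddClosure T X) :
    Module.Finite A X := by
  obtain ⟨n, Y, ⟨e⟩⟩ := h
  exact Module.Finite.of_surjective (LinearMap.fst A X Y ∘ₗ e.symm.toLinearMap)
    ((Prod.fst_surjective (β := Y)).comp e.symm.surjective)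

instance finite_finSum {ι : Type} [Finite ι] {M : ι → ModuleCat.{u} A}
    [∀ i, Module.Finite A (M i)] : Module.Finite A (finSum M) :=
  inferInstanceAs (Module.Finite A (∀ i, M i))

lemma addClosure_finSum_iff_memAdd {ι : Type} [Finite ι] {M : ι → ModuleCat.{u} A} :
    AddClosure (finSum M) X ↔ MemAdd M X := by
  classical
  rw [addClosure_iff_memAdd]
  refine ⟨.trans fun _ => .finSum .self, .trans fun i => ?_⟩
  refine (MemAdd.self (M := fun _ : Unit => finSum M) ()).of_retract
    (LinearMap.single A (fun i => M i) i) (LinearMap.proj i) ?_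
  exact LinearMap.proj_comp_single_same A (fun i => M i) i

end MemAdd

/-! ### Vanishing of `Ext¹` -/

section Ext

variable {A : Type u} [Ring A] {X Y X₁ X₂ X₃ : ModuleCat.{u} A}

lemma IsShortExact.shortExact {f : X₁ →ₗ[A] X₂} {g : X₂ →ₗ[A] X₃} (h : IsShortExact f g) :
    (ShortComplex.mk (ModuleCat.ofHom f) (ModuleCat.ofHom g)
      (ModuleCat.hom_ext h.exact.linearMap_comp_eq_zero)).ShortExact where
  exact := (ShortComplex.ShortExact.moduleCat_exact_iff_function_exact _).2 h.exact
  mono_f := (ModuleCat.mono_iff_injective _).2 h.injective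
  epi_g := (ModuleCat.epi_iff_surjective _).2 h.surjective

lemma isShortExact_of_shortExact {S : ShortComplex (ModuleCat.{u} A)} (hS : S.ShortExact) :
    IsShortExact S.f.hom S.g.hom :=
  ⟨hS.moduleCat_injective_f,
    (ShortComplex.ShortExact.moduleCat_exact_iff_function_exact _).1 hS.exact,
    hS.moduleCat_surjective_g⟩

namespace ExtOneVanishes

lemma of_projective (X Y : ModuleCat.{u} A) [Module.Projective A X] : ExtOneVanishes X Y :=
  have := (IsProjective.iff_projective (R := A) X).1 inferInstance
  Abelian.Ext.subsingleton_of_projective ..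

lemma exists_lift (h : ExtOneVanishes X X₁) {f : X₁ →ₗ[A] X₂} {g : X₂ →ₗ[A] X₃}
    (hfg : IsShortExact f g) (φ : X →ₗ[A] X₃) : ∃ ψ : X →ₗ[A] X₂, g ∘ₗ ψ = φ := by
  obtain ⟨x, hx⟩ := Abelian.Ext.covariant_sequence_exact₃ X hfg.shortExact
    (Abelian.Ext.mk₀ (ModuleCat.ofHom φ)) (zero_add 1) (h.elim _ _)
  obtain ⟨ψ, rfl⟩ := (Abelian.Ext.mk₀_bijective X X₂).surjective x
  rw [Abelian.Ext.mk₀_comp_mk₀] at hx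
  exact ⟨ψ.hom, congrArg ModuleCat.Hom.hom ((Abelian.Ext.mk₀_bijective X X₃).injective hx)⟩

lemma of_isShortExact {f : X₁ →ₗ[A] X₂} {g : X₂ →ₗ[A] X₃} (hfg : IsShortExact f g)
    (h₁ : ExtOneVanishes X X₁) (h₃ : ExtOneVanishes X X₃) : ExtOneVanishes X X₂ := by
  refine subsingleton_of_forall_eq 0 fun x => ?_
  obtain ⟨y, rfl⟩ := Abelian.Ext.covariant_sequence_exact₂ X hfg.shortExact x (h₃.elim _ _)
  rw [h₁.elim y 0, Abelian.Ext.zero_comp]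

lemma of_subsingleton (X Y : ModuleCat.{u} A) [Subsingleton Y] : ExtOneVanishes X Y := by
  refine subsingleton_of_forall_eq 0 fun x => ?_
  rw [← x.comp_mk₀_id, (ModuleCat.isZero_of_subsingleton Y).eq_of_src (𝟙 Y) 0,
    Abelian.Ext.mk₀_zero, Abelian.Ext.comp_zero]

lemma of_filteredBy {ι : Type} {C : ι → ModuleCat.{u} A} {p : ι → Prop}
    (hC : ∀ i, p i → ExtOneVanishes X (C i)) (hY : FilteredBy C p Y) : ExtOneVanishes X Y := by
  induction hY using FilteredBy.induction with
  | zero Y => exact of_subsingleton X Y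
  | step hi hfg _ ih => exact .of_isShortExact hfg ih (hC _ hi)

lemma of_memAdd {ι : Type*} {M : ι → ModuleCat.{u} A} (hM : ∀ i, ExtOneVanishes (M i) Y)
    (hX : MemAdd M X) : ExtOneVanishes X Y := by
  refine subsingleton_of_forall_eq 0 fun x => ?_
  let φ : (X →ₗ[A] X) →+ Abelian.Ext.{u} X Y 1 :=
    AddMonoidHom.mk' (fun a => (Abelian.Ext.mk₀ (ModuleCat.ofHom a)).comp x (zero_add 1))
      fun a b => by rw [ModuleCat.ofHom_add, Abelian.Ext.mk₀_add, Abelian.Ext.add_comp]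
  have hφ : mapsThrough M X X ≤ φ.ker := mapsThrough_le fun i f g => by
    change (Abelian.Ext.mk₀ (ModuleCat.ofHom f ≫ ModuleCat.ofHom g)).comp x (zero_add 1) = 0
    rw [← Abelian.Ext.mk₀_comp_mk₀_assoc, (hM i).elim (Abelian.Ext.comp _ x _) 0,
      Abelian.Ext.comp_zero]
  rw [← x.mk₀_id_comp]
  exact hφ hX

end ExtOneVanishes

end Ext

/-! ### Ext-projective stratifying systems -/

namespace IsExtProjectiveStratifyingSystem

variable {A : Type u} [Ring A] {ι : Type} [Finite ι] [LinearOrder ι] {Θ Q : ι → ModuleCat.{u} A}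
  {X Y : ModuleCat.{u} A} (h : IsExtProjectiveStratifyingSystem Θ Q)

include h

lemma exists_isShortExact (i : ι) : ∃ (K : ModuleCat.{u} A) (α : K →ₗ[A] Q i)
    (β : Q i →ₗ[A] Θ i), IsShortExact α β ∧ FilteredBy Θ (fun j => i < j) K := by
  obtain ⟨K, α, β, hα, hαβ, hβ, hK⟩ := h.exists_sequence i
  exact ⟨K, α, β, ⟨hα, hαβ, hβ⟩, hK⟩

lemma filteredBy_Q (i : ι) : FilteredBy Θ (fun j => i ≤ j) (Q i) := by
  obtain ⟨K, α, β, hαβ, hK⟩ := h.exists_isShortExact i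
  exact (hK.mono fun _ => le_of_lt).extend le_rfl hαβ

lemma filtered_Q (i : ι) : Filtered Θ (Q i) :=
  (h.filteredBy_Q i).mono fun _ _ => trivial

lemma filtered_of_memAdd [IsArtinian A X] [IsNoetherian A X] (hX : MemAdd Q X) : Filtered Θ X :=
  .of_memAdd h.indecomposable_Q h.filtered_Q hX

lemma extOneVanishes_of_memAdd (hX : MemAdd Q X) (hY : Filtered Θ Y) : ExtOneVanishes X Y :=
  .of_memAdd (fun i => .of_filteredBy (fun j _ => h.ext_vanishes i j) hY) hX

lemma hom_Q_theta_eq_zero {i j : ι} (hij : j < i) (φ : Q i →ₗ[A] Θ j) : φ = 0 :=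
  (h.filteredBy_Q i).hom_eq_zero (fun k hk f => h.hom_eq_zero k j (hij.trans_le hk) f) φ

lemma exists_hom_Q_theta_ne_zero (i : ι) : ∃ φ : Q i →ₗ[A] Θ i, φ ≠ 0 := by
  obtain ⟨K, α, β, hαβ, -⟩ := h.exists_isShortExact i
  obtain ⟨x, hx⟩ := @exists_ne _ (h.nontrivial_theta i) 0
  obtain ⟨y, rfl⟩ := hαβ.surjective x
  exact ⟨β, fun hβ => hx (LinearMap.congr_fun hβ y)⟩

lemma eq_of_equiv_Q {i j : ι} (e : Q i ≃ₗ[A] Q j) : i = j := by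
  have hle : ∀ {i j : ι}, (Q i ≃ₗ[A] Q j) → i ≤ j := fun {i j} e => by
    by_contra! hij
    obtain ⟨φ, hφ⟩ := h.exists_hom_Q_theta_ne_zero j
    refine hφ (LinearMap.ext fun x => ?_)
    rw [← e.apply_symm_apply x]
    exact LinearMap.congr_fun (h.hom_Q_theta_eq_zero hij (φ ∘ₗ e.toLinearMap)) _
  exact le_antisymm (hle e) (hle e.symm)

lemma exists_cover {p : ι → Prop} (hp : ∀ i j, i ≤ j → p i → p j) (hX : FilteredBy Θ p X) :
    ∃ (Z Y : ModuleCat.{u} A) (f : Z →ₗ[A] Y) (g : Y →ₗ[A] X), IsShortExact f g ∧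
      FilteredBy Θ p Z ∧ MemAdd (fun j : {j // p j} => Q j) Y := by
  induction hX using FilteredBy.induction with
  | zero X =>
    exact ⟨_, X, _, _, .zero_id, .of_subsingleton (ModuleCat.of A PUnit), .of_subsingleton X⟩
  | @step X' X i a b hi hab hX' ih =>
    obtain ⟨Z, Y, f, g, hfg, hZ, hY⟩ := ih
    obtain ⟨K, α, β, hαβ, hK⟩ := h.exists_isShortExact i
    obtain ⟨γ, hγ⟩ := (h.extOneVanishes_of_memAdd (.self i)
      (hX'.mono fun _ _ => trivial)).exists_lift hab β
    obtain ⟨π, k, l, hπ, hkl⟩ := hab.exists_horseshoe hfg hαβ hγ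
    exact ⟨ModuleCat.of A (LinearMap.ker π), ModuleCat.of A (Y × Q i), _, π, .of_surjective hπ,
      .of_isShortExact (Y := ModuleCat.of A (LinearMap.ker π)) hkl hZ
        (hK.mono fun j hj => hp i j hj.le hi),
      hY.prod (.self (M := fun j : {j // p j} => Q j) ⟨i, hi⟩)⟩

lemma exists_cover_of_filtered (hX : Filtered Θ X) :
    ∃ (Z Y : ModuleCat.{u} A) (f : Z →ₗ[A] Y) (g : Y →ₗ[A] X), IsShortExact f g ∧
      Filtered Θ Z ∧ MemAdd Q Y := by
  obtain ⟨Z, Y, f, g, hfg, hZ, hY⟩ := h.exists_cover (fun _ _ _ _ => trivial) hX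
  exact ⟨Z, Y, f, g, hfg, hZ, hY.of_comp⟩

lemma memAdd_of_leftPerpOne (hX : Filtered Θ X) (hX' : LeftPerpOne (Filtered Θ) X) :
    MemAdd Q X := by
  obtain ⟨Z, Y, f, g, hfg, hZ, hY⟩ := h.exists_cover_of_filtered hX
  obtain ⟨s, hs⟩ := (hX'.2 Z hZ).exists_lift hfg LinearMap.id
  exact hY.of_retract s g hs

lemma addClosure_finSum_eq [IsArtinianRing A] :
    AddClosure (finSum Q) = Filtered Θ ⊓ LeftPerpOne (Filtered Θ) := by
  ext X
  refine ⟨fun hX => ?_, fun hX =>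
    addClosure_finSum_iff_memAdd.2 (h.memAdd_of_leftPerpOne hX.1 hX.2)⟩
  have := h.finite_Q
  have := AddClosure.finite hX
  replace hX := addClosure_finSum_iff_memAdd.1 hX
  exact ⟨h.filtered_of_memAdd hX, this, fun Y hY => h.extOneVanishes_of_memAdd hX hY⟩

end IsExtProjectiveStratifyingSystem

/-! ### Functors between module categories -/

section Functors

variable {A B : Type u} [Ring A] [Ring B] {X Y Z : ModuleCat.{u} A}

/-- The linear map `F X → F Y` induced by a linear map `X → Y`. -/
abbrev mapHom (F : ModuleCat.{u} A ⥤ ModuleCat.{u} B) (f : X →ₗ[A] Y) : F.obj X →ₗ[B] F.obj Y :=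
  (F.map (ModuleCat.ofHom f)).hom

lemma mapHom_comp (F : ModuleCat.{u} A ⥤ ModuleCat.{u} B) (g : Y →ₗ[A] Z) (f : X →ₗ[A] Y) :
    mapHom F (g ∘ₗ f) = mapHom F g ∘ₗ mapHom F f := by
  rw [mapHom, ModuleCat.ofHom_comp, F.map_comp, ModuleCat.hom_comp]

lemma mapHom_id (F : ModuleCat.{u} A ⥤ ModuleCat.{u} B) :
    mapHom F (LinearMap.id : X →ₗ[A] X) = LinearMap.id :=
  congrArg ModuleCat.Hom.hom (F.map_id X)

lemma mapHom_zero (F : ModuleCat.{u} A ⥤ ModuleCat.{u} B) [F.PreservesZeroMorphisms] :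
    mapHom F (0 : X →ₗ[A] Y) = 0 :=
  congrArg ModuleCat.Hom.hom (F.map_zero X Y)

lemma mapHom_neg (F : ModuleCat.{u} A ⥤ ModuleCat.{u} B) [F.Additive] (f : X →ₗ[A] Y) :
    mapHom F (-f) = -mapHom F f :=
  congrArg ModuleCat.Hom.hom (F.map_neg (f := ModuleCat.ofHom f))

lemma mapHom_naturality {F G : ModuleCat.{u} A ⥤ ModuleCat.{u} B} (α : F ⟶ G) (f : X →ₗ[A] Y) :
    mapHom G f ∘ₗ (α.app X).hom = (α.app Y).hom ∘ₗ mapHom F f := by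
  rw [← ModuleCat.hom_comp, ← ModuleCat.hom_comp, α.naturality]

lemma isIso_app_of_isShortExact {F G : ModuleCat.{u} A ⥤ ModuleCat.{u} B} (α : F ⟶ G)
    {f : X →ₗ[A] Y} {g : Y →ₗ[A] Z} (hF : IsShortExact (mapHom F f) (mapHom F g))
    (hG : IsShortExact (mapHom G f) (mapHom G g)) [IsIso (α.app X)] [IsIso (α.app Z)] :
    IsIso (α.app Y) :=
  ShortComplex.isIso₂_of_shortExact_of_isIso₁₃' (S₁ := .mk _ _ _) (S₂ := .mk _ _ _)
    (ShortComplex.homMk (α.app X) (α.app Y) (α.app Z) (α.naturality _).symm (α.naturality _).symm)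
    hF.shortExact hG.shortExact ‹_› ‹_›

lemma isIso_app_of_exact {F G : ModuleCat.{u} A ⥤ ModuleCat.{u} B} (α : F ⟶ G)
    {f : X →ₗ[A] Y} {g : Y →ₗ[A] Z} (hF : Function.Exact (mapHom F f) (mapHom F g))
    (hF' : Function.Surjective (mapHom F g)) (hG : Function.Exact (mapHom G f) (mapHom G g))
    (hG' : Function.Surjective (mapHom G g)) [Epi (α.app X)] [IsIso (α.app Y)] :
    IsIso (α.app Z) :=
  (ConcreteCategory.isIso_iff_bijective (α.app Z)).2 <|
    AddMonoidHom.bijective_of_surjective_of_bijective_of_right_exact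
      (mapHom F f).toAddMonoidHom (mapHom F g).toAddMonoidHom (mapHom G f).toAddMonoidHom
      (mapHom G g).toAddMonoidHom (α.app X).hom.toAddMonoidHom (α.app Y).hom.toAddMonoidHom
      (α.app Z).hom.toAddMonoidHom (congrArg LinearMap.toAddMonoidHom (mapHom_naturality α f))
      (congrArg LinearMap.toAddMonoidHom (mapHom_naturality α g)) hF hG
      ((ModuleCat.epi_iff_surjective _).1 ‹_›) ((ConcreteCategory.isIso_iff_bijective _).1 ‹_›)
      hF' hG'

section RightExact

variable {F : ModuleCat.{u} A ⥤ ModuleCat.{u} B} [F.Additive] [Limits.PreservesFiniteColimits F]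

variable (F) in
lemma IsShortExact.exact_mapHom {f : X →ₗ[A] Y} {g : Y →ₗ[A] Z} (h : IsShortExact f g) :
    Function.Exact (mapHom F f) (mapHom F g) ∧ Function.Surjective (mapHom F g) := by
  obtain ⟨hex, hepi⟩ := ((Functor.preservesFiniteColimits_tfae F).out 3 0 :).1 ‹_› _ h.shortExact
  exact ⟨(ShortComplex.ShortExact.moduleCat_exact_iff_function_exact _).1 hex,
    (ModuleCat.epi_iff_surjective _).1 hepi⟩

lemma IsShortExact.mapHom_of_projective_presentation {K P Y' : ModuleCat.{u} A}
    [Module.Projective A P] {k : K →ₗ[A] P} {p : P →ₗ[A] Z} (hkp : IsShortExact k p)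
    (hk : Function.Injective (mapHom F k)) {f : Y' →ₗ[A] Y} {g : Y →ₗ[A] Z}
    (hfg : IsShortExact f g) : IsShortExact (mapHom F f) (mapHom F g) := by
  obtain ⟨hex, hsurj⟩ := hfg.exact_mapHom F
  refine ⟨(injective_iff_map_eq_zero _).2 fun x hx => ?_, hex, hsurj⟩
  obtain ⟨l, hl⟩ := Module.projective_lifting_property g p hfg.surjective
  obtain ⟨μ, hμ⟩ := hfg.exists_prod_neg_coprod hkp hl
  let Y'P := ModuleCat.of A (Y' × P)
  let inl : Y' →ₗ[A] Y'P := LinearMap.inl A Y' P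
  let fst : Y'P →ₗ[A] Y' := LinearMap.fst A Y' P
  let snd : Y'P →ₗ[A] P := LinearMap.snd A Y' P
  obtain ⟨c, hc⟩ := ((hμ.exact_mapHom (X := K) (Y := Y'P) F).1 (mapHom F inl x)).1 (by
    rw [← LinearMap.comp_apply, ← mapHom_comp, LinearMap.coprod_inl, hx])
  have hkc : mapHom F (-k) c = 0 :=
    calc mapHom F (-k) c = mapHom F snd (mapHom F inl x) := by
          rw [← hc, ← LinearMap.comp_apply, ← mapHom_comp, LinearMap.snd_prod]
      _ = 0 := by
          rw [← LinearMap.comp_apply, ← mapHom_comp, LinearMap.snd_comp_inl, mapHom_zero,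
            LinearMap.zero_apply]
  have hc0 : c = 0 := by
    rw [mapHom_neg, LinearMap.neg_apply, neg_eq_zero] at hkc
    exact (map_eq_zero_iff _ hk).1 hkc
  calc x = mapHom F fst (mapHom F inl x) := by
        rw [← LinearMap.comp_apply, ← mapHom_comp, LinearMap.fst_comp_inl, mapHom_id,
          LinearMap.id_apply]
    _ = 0 := by rw [← hc, hc0, map_zero, map_zero]

end RightExact

end Functors

/-! ### The adjunction between `M ⊗_Γ -` and `Hom(M, -)` -/

section Adjunction

variable {C D : Type*} [Category* C] [Category* D] {L : C ⥤ D} {R : D ⥤ C} (adj : L ⊣ R)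

include adj

lemma map_bijective_of_isIso_counit_app {Y : D} [IsIso (adj.counit.app Y)] (Y' : D) :
    Function.Bijective (R.map : (Y ⟶ Y') → (R.obj Y ⟶ R.obj Y')) := by
  have hmap : (R.map : (Y ⟶ Y') → _) =
      adj.homEquiv (R.obj Y) Y' ∘ (asIso (adj.counit.app Y)).homFromEquiv.symm :=
    funext fun f => by simp [Adjunction.homEquiv_unit]
  rw [hmap]
  exact (Equiv.bijective _).comp (Equiv.bijective _)

lemma isIso_unit_app_of_isIso_counit_app {Y : D} [IsIso (adj.counit.app Y)] :
    IsIso (adj.unit.app (R.obj Y)) :=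
  isIso_of_comp_hom_eq_id _ (adj.right_triangle_components Y)

lemma exists_equivalence_fullSubcategory {P : ObjectProperty C} {Q : ObjectProperty D}
    (hL : ∀ X : P.FullSubcategory, Q (L.obj X.obj)) (hR : ∀ Y : Q.FullSubcategory, P (R.obj Y.obj))
    (hunit : ∀ X, P X → IsIso (adj.unit.app X)) (hcounit : ∀ Y, Q Y → IsIso (adj.counit.app Y)) :
    ∃ e : Q.FullSubcategory ≌ P.FullSubcategory,
      e.functor = P.lift (Q.ι ⋙ R) hR ∧ e.inverse = Q.lift (P.ι ⋙ L) hL := by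
  let adj' : Q.lift (P.ι ⋙ L) hL ⊣ P.lift (Q.ι ⋙ R) hR :=
    adj.restrictFullyFaithful P.fullyFaithfulι Q.fullyFaithfulι (Iso.refl _) (Iso.refl _)
  have (X : P.FullSubcategory) : IsIso (adj'.unit.app X) := by
    have := hunit X.obj X.property
    refine @isIso_of_fully_faithful _ _ _ _ P.ι _ _ _ _ _ ?_
    simpa [adj', adj.map_restrictFullyFaithful_unit_app]
  have (Y : Q.FullSubcategory) : IsIso (adj'.counit.app Y) := by
    have := hcounit Y.obj Y.property
    refine @isIso_of_fully_faithful _ _ _ _ Q.ι _ _ _ _ _ ?_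
    simpa [adj', adj.map_restrictFullyFaithful_counit_app]
  exact ⟨adj'.toEquivalence.symm, rfl, rfl⟩

end Adjunction

section TensorHom

variable {Λ : Type u} [Ring Λ] (M : ModuleCat.{u} Λ)

variable {M} in
/-- The element `m ⊗ y` of `M ⊗_Γ Y`. -/
def tensorMk {Y : ModuleCat.{u} (EndOp M)} (m : M) (y : Y) : (tensorFunctor M).obj Y :=
  Submodule.Quotient.mk (m ⊗ₜ[ℤ] y)

lemma tensorMk_add_left {Y : ModuleCat.{u} (EndOp M)} (m m' : M) (y : Y) :
    tensorMk (m + m') y = tensorMk m y + tensorMk m' y := by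
  rw [tensorMk, TensorProduct.add_tmul]
  rfl

lemma tensorMk_add_right {Y : ModuleCat.{u} (EndOp M)} (m : M) (y y' : Y) :
    tensorMk m (y + y') = tensorMk m y + tensorMk m y' := by
  rw [tensorMk, TensorProduct.tmul_add]
  rfl

lemma tensorMk_smul_right {Y : ModuleCat.{u} (EndOp M)} (m : M) (γ : EndOp M) (y : Y) :
    tensorMk m (γ • y) = tensorMk (γ.unop m) y :=
  ((Submodule.Quotient.eq (balancedRel M Y)).2 (Submodule.subset_span ⟨m, γ, y, rfl⟩)).symm

variable {M} in
lemma tensor_hom_ext {Y : ModuleCat.{u} (EndOp M)} {X : ModuleCat.{u} Λ}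
    {f g : (tensorFunctor M).obj Y ⟶ X}
    (h : ∀ m y, f.hom (tensorMk m y) = g.hom (tensorMk m y)) : f = g :=
  ModuleCat.hom_ext (Submodule.linearMap_qext _ (TensorProduct.AlgebraTensorModule.ext h))

/-- The evaluation map `M ⊗_Γ Hom(M, X) → X`. -/
def evalMap (X : ModuleCat.{u} Λ) :
    (tensorFunctor M).obj ((homFunctor M).obj X) →ₗ[Λ] X :=
  Submodule.liftQ _ (TensorProduct.AlgebraTensorModule.lift
    { toFun := fun m =>
        { toFun := fun h : M →ₗ[Λ] X => h m
          map_add' := fun _ _ => rfl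
          map_smul' := fun _ _ => rfl }
      map_add' := fun m m' => LinearMap.ext fun h : M →ₗ[Λ] X => map_add h m m'
      map_smul' := fun r m => LinearMap.ext fun h : M →ₗ[Λ] X => map_smul h r m }) (by
    refine Submodule.span_le.2 ?_
    rintro _ ⟨m, γ, y, rfl⟩
    rw [SetLike.mem_coe, LinearMap.mem_ker, map_sub]
    exact sub_self (G := X) ((show M →ₗ[Λ] X from y) (γ.unop m)))

/-- The map `Y → Hom(M, M ⊗_Γ Y)`. -/
def coevalMap (Y : ModuleCat.{u} (EndOp M)) :
    Y →ₗ[EndOp M] (homFunctor M).obj ((tensorFunctor M).obj Y) where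
  toFun y := show M →ₗ[Λ] (tensorFunctor M).obj Y from
    { toFun := fun m => tensorMk m y
      map_add' := fun m m' => tensorMk_add_left M m m' y
      map_smul' := fun _ _ => rfl }
  map_add' y y' := LinearMap.ext fun m => tensorMk_add_right M m y y'
  map_smul' γ y := LinearMap.ext fun m => tensorMk_smul_right M m γ y

/-- The adjunction between `M ⊗_Γ -` and `Hom(M, -)`. -/
def tensorHomAdjunction : tensorFunctor M ⊣ homFunctor M :=
  Adjunction.mkOfUnitCounit
    { unit :=
        { app := fun Y => ModuleCat.ofHom (coevalMap M Y)
          naturality := fun _ _ _ => rfl }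
      counit :=
        { app := fun X => ModuleCat.ofHom (evalMap M X)
          naturality := fun _ _ _ => tensor_hom_ext fun _ _ => rfl }
      left_triangle := by
        ext Y : 2
        exact tensor_hom_ext fun _ _ => rfl
      right_triangle := by
        ext X : 2
        rfl }

instance : (tensorFunctor M).Additive where
  map_add {_ _ _ _} := tensor_hom_ext fun m _ => tensorMk_add_right M m _ _

end TensorHom

/-! ### Modules over the endomorphism ring -/

section HomFunctor

variable {Λ : Type u} [Ring Λ] {M X Y Z : ModuleCat.{u} Λ}

instance : Limits.PreservesFiniteColimits (tensorFunctor M) :=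
  have := (tensorHomAdjunction M).leftAdjoint_preservesColimits
  inferInstance

variable (M) in
instance isIso_counit_app_self : IsIso ((tensorHomAdjunction M).counit.app M) := by
  let v : (homFunctor M).obj M := (LinearMap.id : M →ₗ[Λ] M)
  refine ⟨ModuleCat.ofHom (coevalMap M _ v : M →ₗ[Λ] _), tensor_hom_ext fun m h => ?_, rfl⟩
  exact (tensorMk_smul_right M m (MulOpposite.op (show M →ₗ[Λ] M from h)) v).symm

lemma isIso_counit_app_of_addClosure (hX : AddClosure M X) :
    IsIso ((tensorHomAdjunction M).counit.app X) :=
  (addClosure_iff_memAdd.1 hX).isIso_app (F := homFunctor M ⋙ tensorFunctor M) (G := 𝟭 _) _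

namespace IsShortExact

variable {f : X →ₗ[Λ] Y} {g : Y →ₗ[Λ] Z}

lemma mapHom_homFunctor (h : IsShortExact f g) (hM : ExtOneVanishes M X) :
    IsShortExact (mapHom (homFunctor M) f) (mapHom (homFunctor M) g) where
  injective φ ψ hφψ := LinearMap.ext fun m =>
    h.injective (LinearMap.congr_fun (show f ∘ₗ φ = f ∘ₗ ψ from hφψ) m)
  exact φ := by
    refine ⟨fun hφ => h.exists_comp_left_eq (φ := φ) hφ, ?_⟩
    rintro ⟨ψ, rfl⟩
    exact LinearMap.ext fun m => h.exact.apply_apply_eq_zero ((show M →ₗ[Λ] X from ψ) m)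
  surjective φ := hM.exists_lift h φ

end IsShortExact

variable (M) in
/-- The regular module of `Γ = End(M)ᵒᵖ` as the module `Hom(M, M)`. -/
def regularEquiv : EndOp M ≃ₗ[EndOp M] (homFunctor M).obj M where
  toFun γ := γ.unop
  invFun h := MulOpposite.op (show M →ₗ[Λ] M from h)
  map_add' _ _ := rfl
  map_smul' _ _ := rfl
  left_inv _ := rfl
  right_inv _ := rfl

section FinSum

variable {ι : Type} [Finite ι] (Q : ι → ModuleCat.{u} Λ)

variable (M) in
/-- The isomorphism of `Hom(M, ⨁ Q(i))` with the direct sum of the `Hom(M, Q(i))`. -/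
def homFinSumEquiv :
    (homFunctor M).obj (finSum Q) ≃ₗ[EndOp M] ∀ i, (homFunctor M).obj (Q i) where
  toFun h i := (LinearMap.proj i ∘ₗ (show M →ₗ[Λ] ∀ i, Q i from h) : M →ₗ[Λ] Q i)
  invFun f := (LinearMap.pi fun i => (show M →ₗ[Λ] Q i from f i) : M →ₗ[Λ] ∀ i, Q i)
  map_add' _ _ := rfl
  map_smul' _ _ := rfl
  left_inv _ := rfl
  right_inv _ := rfl

variable (M) in
lemma finite_tensorFunctor_obj [Module.Finite Λ M] (Y : ModuleCat.{u} (EndOp M))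
    [Module.Finite (EndOp M) Y] : Module.Finite Λ ((tensorFunctor M).obj Y) := by
  obtain ⟨n, p, hp⟩ := Module.Finite.exists_fin' (EndOp M) Y
  let Mn := finSum fun _ : Fin n => M
  let e : (homFunctor M).obj Mn ≃ₗ[EndOp M] (Fin n → EndOp M) :=
    homFinSumEquiv M _ ≪≫ₗ LinearEquiv.piCongrRight fun _ => (regularEquiv M).symm
  let q : (homFunctor M).obj Mn →ₗ[EndOp M] Y := p ∘ₗ e.toLinearMap
  have hq : Function.Surjective (mapHom (tensorFunctor M) q) :=
    ((IsShortExact.of_surjective (g := q) (hp.comp e.surjective)).exact_mapHom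
      (X := ModuleCat.of _ (LinearMap.ker q)) _).2
  have : IsIso ((tensorHomAdjunction M).counit.app Mn) :=
    isIso_counit_app_of_addClosure
      (addClosure_iff_memAdd.2 (.finSum fun _ => .self (M := fun _ : Unit => M) ()))
  have counitEquiv : (tensorFunctor M).obj ((homFunctor M).obj Mn) ≃ₗ[Λ] Mn :=
    (asIso ((tensorHomAdjunction M).counit.app Mn)).toLinearEquiv
  have : Module.Finite Λ Mn := finite_finSum
  have := Module.Finite.equiv counitEquiv.symm
  exact .of_surjective _ hq

/-- The projective `Γ`-modules `P(i) = Hom(⨁ Q(j), Q(i))`, where `Γ = End(⨁ Q(j))ᵒᵖ`. -/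
abbrev homProjective (i : ι) : ModuleCat.{u} (EndOp (finSum Q)) :=
  (homFunctor (finSum Q)).obj (Q i)

lemma exists_split_homProjective (i : ι) :
    ∃ (s : homProjective Q i →ₗ[EndOp (finSum Q)] EndOp (finSum Q))
      (r : EndOp (finSum Q) →ₗ[EndOp (finSum Q)] homProjective Q i), r ∘ₗ s = LinearMap.id := by
  classical
  let e := regularEquiv (finSum Q) ≪≫ₗ homFinSumEquiv (finSum Q) Q
  refine ⟨e.symm.toLinearMap ∘ₗ LinearMap.single _ (fun i => homProjective Q i) i,
    LinearMap.proj i ∘ₗ e.toLinearMap,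
    LinearMap.ext fun x => ?_⟩
  change e (e.symm (Pi.single i x)) i = x
  rw [e.apply_symm_apply, Pi.single_eq_same]

instance projective_homProjective (i : ι) :
    Module.Projective (EndOp (finSum Q)) (homProjective Q i) := by
  obtain ⟨s, r, hrs⟩ := exists_split_homProjective Q i
  exact .of_split s r hrs

instance finite_homProjective (i : ι) : Module.Finite (EndOp (finSum Q)) (homProjective Q i) := by
  obtain ⟨s, r, hrs⟩ := exists_split_homProjective Q i
  exact .of_surjective r fun x => ⟨s x, LinearMap.congr_fun hrs x⟩

variable {Q} in
lemma memAdd_homProjective_of_projective (Y : ModuleCat.{u} (EndOp (finSum Q)))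
    [Module.Finite (EndOp (finSum Q)) Y] [Module.Projective (EndOp (finSum Q)) Y] :
    MemAdd (homProjective Q) Y := by
  obtain ⟨n, p, hp⟩ := Module.Finite.exists_fin' (EndOp (finSum Q)) Y
  obtain ⟨s, hs⟩ := Module.projective_lifting_property p LinearMap.id hp
  have hreg : MemAdd (homProjective Q) (ModuleCat.of _ (EndOp (finSum Q))) :=
    .of_equiv (regularEquiv (finSum Q) ≪≫ₗ homFinSumEquiv (finSum Q) Q).symm
      (MemAdd.finSum (M := homProjective Q) .self)
  exact .of_retract (Y := finSum fun _ : Fin n => ModuleCat.of _ (EndOp (finSum Q))) s p hs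
    (.finSum fun _ => hreg)

end FinSum

end HomFunctor

/-! ### Standard modules and the equivalence of `𝓕(Θ)` and `𝓕(Δ)` -/

section Trace

variable {A : Type u} [Ring A] {κ : Type} [Finite κ] {M : κ → ModuleCat.{u} A}
  {X Y Z : ModuleCat.{u} A}

lemma range_le_trace_finSum {k : κ} (g : M k →ₗ[A] Y) :
    LinearMap.range g ≤ trace (finSum M) Y := by
  classical
  refine le_trans ?_ (le_iSup (fun f : finSum M →ₗ[A] Y => LinearMap.range f)
    (g ∘ₗ (LinearMap.proj k : (∀ k, M k) →ₗ[A] M k)))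
  exact (LinearMap.range_comp_of_range_eq_top g
    (LinearMap.range_eq_top.2 (LinearMap.proj_surjective k))).ge

lemma trace_finSum_le_ker {g : Y →ₗ[A] Z} (h : ∀ (k : κ) (f : M k →ₗ[A] Y), g ∘ₗ f = 0) :
    trace (finSum M) Y ≤ LinearMap.ker g := by
  classical
  have := Fintype.ofFinite κ
  refine iSup_le fun φ => LinearMap.range_le_ker_iff.2 ?_
  change (g ∘ₗ φ : (∀ k, M k) →ₗ[A] Z) = 0
  exact LinearMap.pi_ext' fun k =>
    h k ((φ : (∀ k, M k) →ₗ[A] Y) ∘ₗ LinearMap.single A (fun k => M k) k)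

lemma mapHom_mem_trace {B : Type u} [Ring B] (F : ModuleCat.{u} A ⥤ ModuleCat.{u} B) [F.Additive]
    {a : X →ₗ[A] Y} (ha : a ∈ mapsThrough M X Y) (x : F.obj X) :
    mapHom F a x ∈ trace (finSum fun k => F.obj (M k)) (F.obj Y) := by
  let H : AddSubgroup (X →ₗ[A] Y) :=
    { carrier := {a | mapHom F a x ∈ trace (finSum fun k => F.obj (M k)) (F.obj Y)}
      add_mem' := fun {a b} ha hb => by
        change mapHom F (a + b) x ∈ trace _ _
        rw [mapHom, ModuleCat.ofHom_add, F.map_add]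
        exact add_mem ha hb
      zero_mem' := by
        change mapHom F 0 x ∈ trace _ _
        rw [mapHom_zero]
        exact zero_mem _
      neg_mem' := fun {a} ha => by
        change mapHom F (-a) x ∈ trace _ _
        rw [mapHom_neg]
        exact neg_mem ha }
  refine mapsThrough_le (H := H) (fun k f g => ?_) ha
  change mapHom F (g ∘ₗ f) x ∈ trace _ _
  rw [mapHom_comp]
  exact range_le_trace_finSum (M := fun k => F.obj (M k)) (mapHom F g) ⟨_, rfl⟩

end Trace

namespace IsExtProjectiveStratifyingSystem

variable {A : Type u} [Ring A] {ι : Type} [Finite ι] [LinearOrder ι] {Θ Q : ι → ModuleCat.{u} A}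
  {X Y Z : ModuleCat.{u} A} (h : IsExtProjectiveStratifyingSystem Θ Q)

include h

lemma isShortExact_mapHom {f : X →ₗ[A] Y} {g : Y →ₗ[A] Z} (hfg : IsShortExact f g)
    (hX : Filtered Θ X) :
    IsShortExact (mapHom (homFunctor (finSum Q)) f) (mapHom (homFunctor (finSum Q)) g) :=
  hfg.mapHom_homFunctor (h.extOneVanishes_of_memAdd (.finSum .self) hX)

lemma shortExact_map_homFunctor {S : ShortComplex (ModuleCat.{u} A)} (hS : S.ShortExact)
    (h₁ : Filtered Θ S.X₁) : (S.map (homFunctor (finSum Q))).ShortExact :=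
  (h.isShortExact_mapHom (isShortExact_of_shortExact hS) h₁).shortExact

lemma epi_counit_app (hX : Filtered Θ X) :
    Epi ((tensorHomAdjunction (finSum Q)).counit.app X) := by
  obtain ⟨Z, Y, f, g, hfg, -, hY⟩ := h.exists_cover_of_filtered hX
  have := isIso_counit_app_of_addClosure (addClosure_finSum_iff_memAdd.2 hY)
  have hcounit := ((ConcreteCategory.isIso_iff_bijective _).1 this).surjective
  have hnat := mapHom_naturality (F := homFunctor (finSum Q) ⋙ tensorFunctor (finSum Q))
    (G := 𝟭 _) (tensorHomAdjunction (finSum Q)).counit g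
  refine (ModuleCat.epi_iff_surjective _).2 (Function.Surjective.of_comp
    (g := mapHom (homFunctor (finSum Q) ⋙ tensorFunctor (finSum Q)) g) ?_)
  exact (congrArg DFunLike.coe hnat).subst (hfg.surjective.comp hcounit)

lemma isIso_counit_app (hX : Filtered Θ X) :
    IsIso ((tensorHomAdjunction (finSum Q)).counit.app X) := by
  obtain ⟨Z, Y, f, g, hfg, hZ, hY⟩ := h.exists_cover_of_filtered hX
  have := isIso_counit_app_of_addClosure (addClosure_finSum_iff_memAdd.2 hY)
  have := h.epi_counit_app hZ
  obtain ⟨hex, hsurj⟩ := (h.isShortExact_mapHom hfg hZ).exact_mapHom (tensorFunctor (finSum Q))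
  exact isIso_app_of_exact (F := homFunctor (finSum Q) ⋙ tensorFunctor (finSum Q)) (G := 𝟭 _)
    (tensorHomAdjunction (finSum Q)).counit hex hsurj hfg.exact hfg.surjective

lemma mapHom_bijective (hX : Filtered Θ X) (Y : ModuleCat.{u} A) :
    Function.Bijective (mapHom (homFunctor (finSum Q)) : (X →ₗ[A] Y) → _) := by
  have := h.isIso_counit_app hX
  exact ModuleCat.homEquiv.bijective.comp
    ((map_bijective_of_isIso_counit_app (tensorHomAdjunction (finSum Q)) Y).comp
      ModuleCat.homEquiv.symm.bijective)

lemma hom_homProjective_theta_eq_zero {i j : ι} (hij : j < i)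
    (φ : homProjective Q i →ₗ[EndOp (finSum Q)] (homFunctor (finSum Q)).obj (Θ j)) : φ = 0 := by
  obtain ⟨ψ, rfl⟩ := (h.mapHom_bijective (h.filtered_Q i) (Θ j)).surjective φ
  rw [h.hom_Q_theta_eq_zero hij ψ, mapHom_zero]

lemma range_mapHom_le_trace {p : ι → Prop} (hp : ∀ i j, i ≤ j → p i → p j) (hX : FilteredBy Θ p X)
    (f : X →ₗ[A] Y) : LinearMap.range (mapHom (homFunctor (finSum Q)) f) ≤
      trace (finSum fun j : {j // p j} => homProjective Q j) ((homFunctor (finSum Q)).obj Y) := by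
  rintro _ ⟨x, rfl⟩
  obtain ⟨Z, X', k, g, hkg, hZ, hX'⟩ := h.exists_cover hp hX
  obtain ⟨x, rfl⟩ := (h.isShortExact_mapHom hkg (hZ.mono fun _ _ => trivial)).surjective x
  rw [← LinearMap.comp_apply, ← mapHom_comp]
  exact mapHom_mem_trace _ (hX'.comp_mem_mapsThrough LinearMap.id (f ∘ₗ g)) x

lemma nonempty_equiv_standardModule (i : ι) : Nonempty ((homFunctor (finSum Q)).obj (Θ i)
    ≃ₗ[EndOp (finSum Q)] standardModule (homProjective Q) i) := by
  obtain ⟨K, α, β, hαβ, hK⟩ := h.exists_isShortExact i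
  have hF := h.isShortExact_mapHom hαβ (hK.mono fun _ _ => trivial)
  have htrace : trace (finSum fun j : {j // i < j} => homProjective Q j) (homProjective Q i) =
      LinearMap.ker (mapHom (homFunctor (finSum Q)) β) := by
    refine le_antisymm (trace_finSum_le_ker fun j f =>
      h.hom_homProjective_theta_eq_zero j.2 _) ?_
    rw [hF.exact.linearMap_ker_eq]
    exact h.range_mapHom_le_trace (fun _ _ hjk hij => hij.trans_le hjk) hK α
  exact ⟨((Submodule.quotEquivOfEq _ _ htrace).trans
    ((mapHom (homFunctor (finSum Q)) β).quotKerEquivOfSurjective hF.surjective)).symm⟩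

lemma filtered_standardModule : Filtered (standardModule (homProjective Q)) =
    Filtered fun i => (homFunctor (finSum Q)).obj (Θ i) := by
  ext Y
  refine ⟨.trans fun i _ => ?_, .trans fun i _ => ?_⟩ <;>
    obtain ⟨e⟩ := h.nonempty_equiv_standardModule i
  · exact (FilteredBy.single (C := fun i => (homFunctor (finSum Q)).obj (Θ i))
      (p := fun _ => True) trivial).of_equiv e
  · exact (FilteredBy.single (p := fun _ => True) trivial).of_equiv e.symm

lemma filtered_homFunctor_obj (hX : Filtered Θ X) :
    Filtered (fun i => (homFunctor (finSum Q)).obj (Θ i)) ((homFunctor (finSum Q)).obj X) := by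
  induction hX using FilteredBy.induction with
  | zero X =>
    have : Subsingleton ((homFunctor (finSum Q)).obj X) :=
      inferInstanceAs (Subsingleton (finSum Q →ₗ[A] X))
    exact .of_subsingleton _
  | step hi hfg hX ih => exact ih.extend hi (h.isShortExact_mapHom hfg hX)

lemma exists_projective_presentation (i : ι) :
    ∃ (L P : ModuleCat.{u} (EndOp (finSum Q))) (k : L →ₗ[EndOp (finSum Q)] P)
      (p : P →ₗ[EndOp (finSum Q)] (homFunctor (finSum Q)).obj (Θ i)),
      Module.Projective (EndOp (finSum Q)) P ∧ IsShortExact k p ∧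
      Function.Injective (mapHom (tensorFunctor (finSum Q)) k) := by
  obtain ⟨K, α, β, hαβ, hK⟩ := h.exists_isShortExact i
  have hK' : Filtered Θ K := hK.mono fun _ _ => trivial
  refine ⟨_, homProjective Q i, _, _, inferInstance, h.isShortExact_mapHom hαβ hK', ?_⟩
  have := h.isIso_counit_app hK'
  have hcounit := ((ConcreteCategory.isIso_iff_bijective _).1 this).injective
  have hnat := mapHom_naturality (F := homFunctor (finSum Q) ⋙ tensorFunctor (finSum Q))
    (G := 𝟭 _) (tensorHomAdjunction (finSum Q)).counit α
  refine Function.Injective.of_comp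
    (f := ((tensorHomAdjunction (finSum Q)).counit.app (Q i)).hom) ?_
  exact (congrArg DFunLike.coe hnat).subst (hαβ.injective.comp hcounit)

lemma filtered_tensorFunctor_obj_and_isIso_unit_app {Y : ModuleCat.{u} (EndOp (finSum Q))}
    (hY : Filtered (fun i => (homFunctor (finSum Q)).obj (Θ i)) Y) :
    Filtered Θ ((tensorFunctor (finSum Q)).obj Y) ∧
      IsIso ((tensorHomAdjunction (finSum Q)).unit.app Y) := by
  induction hY using FilteredBy.induction with
  | zero Y =>
    have hGY : Subsingleton ((tensorFunctor (finSum Q)).obj Y) :=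
      ModuleCat.isZero_iff_subsingleton.1
        ((tensorFunctor (finSum Q)).map_isZero (ModuleCat.isZero_iff_subsingleton.2 ‹_›))
    have hFGY : Subsingleton ((homFunctor (finSum Q)).obj ((tensorFunctor (finSum Q)).obj Y)) :=
      inferInstanceAs (Subsingleton (finSum Q →ₗ[A] _))
    exact ⟨.of_subsingleton _, (ModuleCat.isZero_iff_subsingleton.2 ‹_›).isIso
      (ModuleCat.isZero_iff_subsingleton.2 hFGY) _⟩
  | @step Y' Y i f g _ hfg _ ih =>
    obtain ⟨hGY', hunit⟩ := ih
    have hcounit := h.isIso_counit_app (.single (C := Θ) (i := i) trivial)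
    obtain ⟨L, P, k, p, hP, hkp, hk⟩ := h.exists_projective_presentation i
    have hGfg := hkp.mapHom_of_projective_presentation hk hfg
    have hGΘ : Filtered Θ
        ((tensorFunctor (finSum Q)).obj ((homFunctor (finSum Q)).obj (Θ i))) :=
      (FilteredBy.single (C := Θ) (p := fun _ => True) (i := i) trivial).of_equiv
        (asIso ((tensorHomAdjunction (finSum Q)).counit.app (Θ i))).symm.toLinearEquiv
    have := isIso_unit_app_of_isIso_counit_app (tensorHomAdjunction (finSum Q)) (Y := Θ i)
    exact ⟨.of_isShortExact hGfg hGY' hGΘ,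
      isIso_app_of_isShortExact (F := 𝟭 _) (G := tensorFunctor (finSum Q) ⋙ homFunctor (finSum Q))
        (tensorHomAdjunction (finSum Q)).unit hfg (h.isShortExact_mapHom hGfg hGY')⟩

lemma exists_equivalence :
    ∃ (hF : ∀ X : (Filtered Θ).FullSubcategory,
        Filtered (standardModule (homProjective Q)) ((homFunctor (finSum Q)).obj X.obj))
      (hG : ∀ Y : (Filtered (standardModule (homProjective Q))).FullSubcategory,
        Filtered Θ ((tensorFunctor (finSum Q)).obj Y.obj))
      (e : (Filtered Θ).FullSubcategory ≌
        (Filtered (standardModule (homProjective Q))).FullSubcategory),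
      e.functor = (Filtered (standardModule (homProjective Q))).lift
        ((Filtered Θ).ι ⋙ homFunctor (finSum Q)) hF ∧
      e.inverse = (Filtered Θ).lift
        ((Filtered (standardModule (homProjective Q))).ι ⋙ tensorFunctor (finSum Q)) hG := by
  rw [h.filtered_standardModule]
  have hF := fun X : (Filtered Θ).FullSubcategory => h.filtered_homFunctor_obj X.property
  have hG := fun Y : (Filtered fun i => (homFunctor (finSum Q)).obj (Θ i)).FullSubcategory =>
    (h.filtered_tensorFunctor_obj_and_isIso_unit_app Y.property).1
  exact ⟨hF, hG, exists_equivalence_fullSubcategory (tensorHomAdjunction (finSum Q)) hG hF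
    (fun _ hY => (h.filtered_tensorFunctor_obj_and_isIso_unit_app hY).2)
    fun _ hX => h.isIso_counit_app hX⟩

end IsExtProjectiveStratifyingSystem

/-! ### Endomorphism algebras of modules over artin algebras -/

section ArtinAlgebra

variable (R : Type w) [CommRing R] {Λ : Type u} [Ring Λ] [Algebra R Λ]

lemma finite_hom [IsNoetherianRing R] (X Y : Type*) [AddCommGroup X] [Module R X] [Module Λ X]
    [IsScalarTower R Λ X] [Module.Finite R X] [AddCommGroup Y] [Module R Y] [Module Λ Y]
    [IsScalarTower R Λ Y] [Module.Finite R Y] : Module.Finite R (X →ₗ[Λ] Y) :=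
  .of_injective (LinearMap.restrictScalarsₗ R Λ X Y R) (LinearMap.restrictScalars_injective R)

variable [Module.Finite R Λ] (M : ModuleCat.{u} Λ) [Module.Finite Λ M]

lemma finite_endOp [IsNoetherianRing R] :
    @Module.Finite R (EndOp M) _ _ (endOpAlgebra M R).toModule := by
  let : Module R M := Module.restrictScalars R Λ M
  have : IsScalarTower R Λ M := IsScalarTower.restrictScalars R Λ M
  have := Module.Finite.trans (R := R) Λ M
  have := finite_hom R (Λ := Λ) M M
  exact Module.Finite.equiv (MulOpposite.opLinearEquiv R : Module.End Λ M ≃ₗ[R] EndOp M)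

lemma finite_homFunctor_obj [IsNoetherianRing R] (X : ModuleCat.{u} Λ) [Module.Finite Λ X] :
    Module.Finite (EndOp M) ((homFunctor M).obj X) := by
  let : Module R M := Module.restrictScalars R Λ M
  let : Module R X := Module.restrictScalars R Λ X
  have : IsScalarTower R Λ M := IsScalarTower.restrictScalars R Λ M
  have : IsScalarTower R Λ X := IsScalarTower.restrictScalars R Λ X
  have := Module.Finite.trans (R := R) Λ M
  have := Module.Finite.trans (R := R) Λ X
  have := finite_hom R (Λ := Λ) M X
  have : IsScalarTower R (EndOp M) (M →ₗ[Λ] X) :=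
    ⟨fun r γ φ => LinearMap.ext fun m => φ.map_smul_of_tower r (γ.unop m)⟩
  exact (Module.Finite.of_restrictScalars_finite R (EndOp M) (M →ₗ[Λ] X) :)

lemma isArtinianRing_endOp [IsArtinianRing R] : IsArtinianRing (EndOp M) := by
  let := endOpAlgebra M R
  have := finite_endOp R M
  exact IsArtinianRing.of_finite R (EndOp M)

end ArtinAlgebra

namespace IsExtProjectiveStratifyingSystem

variable {A : Type u} [Ring A] {ι : Type} [Finite ι] [LinearOrder ι] {Θ Q : ι → ModuleCat.{u} A}
  (h : IsExtProjectiveStratifyingSystem Θ Q)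

include h

lemma indecomposable_homProjective (i : ι) : Indecomposable (homProjective Q i) := by
  have hF := h.mapHom_bijective (h.filtered_Q i) (Q i)
  have := nontrivial_of_indecomposable (h.indecomposable_Q i)
  have : Nontrivial (homProjective Q i) := by
    by_contra! hsub
    exact not_subsingleton (Module.End A (Q i))
      ⟨fun a b => hF.injective (LinearMap.ext fun x => Subsingleton.elim _ _)⟩
  refine indecomposable_of_isIdempotentElem fun e he => ?_
  obtain ⟨ψ, rfl⟩ := hF.surjective e
  have hψ : ψ ∘ₗ ψ = ψ := hF.injective ((mapHom_comp _ ψ ψ).trans he)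
  rcases eq_zero_or_eq_one_of_isIdempotentElem (h.indecomposable_Q i) hψ with rfl | rfl
  · exact .inl (mapHom_zero _)
  · exact .inr (mapHom_id _)

lemma eq_of_equiv_homProjective {i j : ι}
    (e : homProjective Q i ≃ₗ[EndOp (finSum Q)] homProjective Q j) : i = j := by
  have hi := h.mapHom_bijective (h.filtered_Q i)
  have hj := h.mapHom_bijective (h.filtered_Q j)
  obtain ⟨f, hf⟩ := (hi (Q j)).surjective e.toLinearMap
  obtain ⟨g, hg⟩ := (hj (Q i)).surjective e.symm.toLinearMap
  refine h.eq_of_equiv_Q (LinearEquiv.ofLinearMap f g ((hj (Q j)).injective ?_)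
    ((hi (Q i)).injective ?_))
  · rw [mapHom_comp, hf, hg, LinearEquiv.comp_symm, mapHom_id]
  · rw [mapHom_comp, hf, hg, LinearEquiv.symm_comp, mapHom_id]

lemma isBasic : IsBasic (EndOp (finSum Q)) := by
  obtain ⟨n, ⟨e⟩⟩ := Finite.exists_equiv_fin ι
  exact ⟨n, fun k => homProjective Q (e.symm k),
    ⟨regularEquiv (finSum Q) ≪≫ₗ homFinSumEquiv (finSum Q) Q ≪≫ₗ
      LinearEquiv.piCongrLeft' _ _ e⟩,
    fun k => h.indecomposable_homProjective _,
    fun k l ⟨i⟩ => e.symm.injective (h.eq_of_equiv_homProjective i.toLinearEquiv)⟩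

variable [IsArtinianRing (EndOp (finSum Q))]

lemma isRepresentativeSet : IsRepresentativeSet (homProjective Q) where
  finite := finite_homProjective Q
  projective := projective_homProjective Q
  indecomposable := h.indecomposable_homProjective
  injective := fun _ _ ⟨e⟩ => h.eq_of_equiv_homProjective e.toLinearEquiv
  exhaustive X _ _ hX := by
    obtain ⟨i, ⟨e⟩⟩ := exists_equiv_of_memAdd h.indecomposable_homProjective hX
      (memAdd_homProjective_of_projective X)
    exact ⟨i, ⟨e.toModuleIso⟩⟩

lemma isStandardlyStratified : IsStandardlyStratified (homProjective Q) where
  representative := h.isRepresentativeSet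
  filtered X _ _ := by
    rw [h.filtered_standardModule]
    exact .of_memAdd h.indecomposable_homProjective
      (fun i => h.filtered_homFunctor_obj (h.filtered_Q i)) (memAdd_homProjective_of_projective X)

end IsExtProjectiveStratifyingSystem

/-! ### The Grothendieck group -/

section GrothendieckGroup

variable {A : Type u} [Ring A]

namespace K0

/-- The class of a finitely generated module in the Grothendieck group. -/
def mk (X : FGMod A) : K0 A := QuotientAddGroup.mk (FreeAbelianGroup.of X)

lemma mk_eq_add {X Y Z : FGMod A} {f : X.1 →ₗ[A] Y.1} {g : Y.1 →ₗ[A] Z.1}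
    (h : IsShortExact f g) : mk Y = mk X + mk Z := by
  have hrel : mk Y - mk X - mk Z = 0 := (QuotientAddGroup.eq_zero_iff _).2
    (AddSubgroup.subset_closure ⟨X, Y, Z, f, g, h.injective, h.exact, h.surjective, rfl⟩)
  rwa [sub_sub, sub_eq_zero] at hrel

lemma mk_of_subsingleton (X : FGMod A) [Subsingleton X.1] : mk X = 0 := by
  have h : IsShortExact (LinearMap.id : X.1 →ₗ[A] X.1) (LinearMap.id : X.1 →ₗ[A] X.1) :=
    ⟨Function.injective_id, fun x => iff_of_true (Subsingleton.elim _ _) ⟨x, rfl⟩,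
      Function.surjective_id⟩
  exact left_eq_add.1 (mk_eq_add h)

lemma span_range_mk : Submodule.span ℤ (Set.range (mk : FGMod A → K0 A)) = ⊤ := by
  refine Submodule.eq_top_iff'.2 fun x => ?_
  obtain ⟨x, rfl⟩ := QuotientAddGroup.mk_surjective x
  induction x using FreeAbelianGroup.induction_on with
  | zero => exact zero_mem _
  | of X => exact Submodule.subset_span ⟨X, rfl⟩
  | neg X h => exact neg_mem h
  | add x y hx hy => exact add_mem hx hy

lemma exists_addMonoidHom_apply_mk_eq {G : Type*} [AddCommGroup G] (d : FGMod A → G)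
    (hd : ∀ {X Y Z : FGMod A} {f : X.1 →ₗ[A] Y.1} {g : Y.1 →ₗ[A] Z.1}, IsShortExact f g →
      d Y = d X + d Z) : ∃ l : K0 A →+ G, ∀ X, l (mk X) = d X := by
  refine ⟨QuotientAddGroup.lift _ (FreeAbelianGroup.lift d) ((AddSubgroup.closure_le _).2 ?_),
    FreeAbelianGroup.lift_apply_of d⟩
  rintro _ ⟨X, Y, Z, f, g, hf, hfg, hg, rfl⟩
  rw [SetLike.mem_coe, AddMonoidHom.mem_ker, map_sub, map_sub, FreeAbelianGroup.lift_apply_of,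
    FreeAbelianGroup.lift_apply_of, FreeAbelianGroup.lift_apply_of, hd ⟨hf, hfg, hg⟩, sub_sub,
    sub_self]

lemma span_range_mk_of_simple [IsArtinianRing A] {ι : Type*} {S : ι → FGMod A}
    (hS : ∀ X : ModuleCat.{u} A, IsSimpleModule A X → ∃ i, Nonempty (X ≃ₗ[A] (S i).1)) :
    Submodule.span ℤ (Set.range fun i => mk (S i)) = ⊤ := by
  rw [eq_top_iff, ← span_range_mk, Submodule.span_le]
  rintro _ ⟨⟨X, hX⟩, rfl⟩
  have hlen : IsFiniteLength A X := isFiniteLength_iff_isNoetherian_isArtinian.2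
    ⟨inferInstance, inferInstance⟩
  suffices ∀ (M : Type u) [AddCommGroup M] [Module A M] (hM : Module.Finite A M),
      IsFiniteLength A M → mk ⟨ModuleCat.of A M, hM⟩ ∈
        Submodule.span ℤ (Set.range fun i => mk (S i)) from this X hX hlen
  intro M _ _ hM hlen
  induction hlen with
  | @of_subsingleton M =>
    rw [mk_of_subsingleton ⟨ModuleCat.of A M, hM⟩]
    exact zero_mem _
  | @of_simple_quotient M _ _ N hsimple _ ih =>
    have hNfin : Module.Finite A N := inferInstance
    obtain ⟨i, ⟨e⟩⟩ := hS (ModuleCat.of A (M ⧸ N)) hsimple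
    have hNM : IsShortExact N.subtype (e.toLinearMap ∘ₗ N.mkQ) :=
      ⟨N.injective_subtype, fun x => by simp, e.surjective.comp N.mkQ_surjective⟩
    rw [mk_eq_add (X := ⟨ModuleCat.of A N, hNfin⟩) hNM]
    exact add_mem (ih hNfin) (Submodule.subset_span ⟨i, rfl⟩)

lemma exists_addMonoidHom_eq_zero_iff (R : Type w) [CommRing R] [IsArtinianRing R] [Algebra R A]
    [Module.Finite R A] (P : ModuleCat.{u} A) [Module.Finite A P] [Module.Projective A P] :
    ∃ l : K0 A →+ ℤ, ∀ X, l (mk X) = 0 ↔ Subsingleton (P →ₗ[A] X.1) := by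
  have := isArtinianRing_endOp R P
  have hfin (X : FGMod A) : Module.length (EndOp P) ((homFunctor P).obj X.1) ≠ ⊤ := by
    have := X.2
    have := finite_homFunctor_obj R P X.1
    exact Module.length_ne_top
  obtain ⟨l, hl⟩ := exists_addMonoidHom_apply_mk_eq (A := A)
    (fun X => ((Module.length (EndOp P) ((homFunctor P).obj X.1)).toNat : ℤ))
    fun {X Y Z f g} h => by
      have hF := h.mapHom_homFunctor (ExtOneVanishes.of_projective P X.1)
      rw [Module.length_eq_add_of_exact _ _ hF.injective hF.surjective hF.exact,
        ENat.toNat_add (hfin X) (hfin Z), Nat.cast_add]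
  refine ⟨l, fun X => ?_⟩
  rw [hl, Nat.cast_eq_zero, ENat.toNat_eq_zero, or_iff_left (hfin X), Module.length_eq_zero_iff]
  rfl

end K0

lemma eq_top_or_eq_top_of_sup_eq_top {P : Type*} [AddCommGroup P] [Module A P]
    [Module.Projective A P] [IsLocalRing (Module.End A P)] {N N' : Submodule A P}
    (h : N ⊔ N' = ⊤) : N = ⊤ ∨ N' = ⊤ := by
  rw [Submodule.sup_eq_range, LinearMap.range_eq_top] at h
  obtain ⟨s, hs⟩ := Module.projective_lifting_property _ LinearMap.id h
  have eq_top {L : Submodule A P} (f : P →ₗ[A] L) (hf : IsUnit (L.subtype ∘ₗ f : Module.End A P)) :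
      L = ⊤ := by
    refine Submodule.eq_top_iff'.2 fun x => ?_
    obtain ⟨y, rfl⟩ := ((Module.End.isUnit_iff _).1 hf).2 x
    exact (f y).2
  rcases IsLocalRing.isUnit_or_isUnit_of_add_one (R := Module.End A P)
    (a := N.subtype ∘ₗ LinearMap.fst A N N' ∘ₗ s) (b := N'.subtype ∘ₗ LinearMap.snd A N N' ∘ₗ s)
    (LinearMap.ext fun x => LinearMap.congr_fun hs x) with hu | hu
  · exact .inl (eq_top _ hu)
  · exact .inr (eq_top _ hu)

lemma nonempty_equiv_quotient_of_isCoatom {P X : Type*} [AddCommGroup P] [Module A P]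
    [AddCommGroup X] [Module A X] [Module.Projective A P] [IsLocalRing (Module.End A P)]
    [IsSimpleModule A X] {N : Submodule A P} (hN : IsCoatom N) {f : P →ₗ[A] X} (hf : f ≠ 0) :
    Nonempty (X ≃ₗ[A] P ⧸ N) := by
  have e := f.quotKerEquivOfSurjective (LinearMap.surjective_of_ne_zero hf)
  have hker : IsCoatom (LinearMap.ker f) := isSimpleModule_iff_isCoatom.1 (.congr e)
  have heq : LinearMap.ker f = N := by
    by_contra hne
    exact (eq_top_or_eq_top_of_sup_eq_top (hker.sup_eq_top_of_ne hN hne)).elim hker.1 hN.1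
  exact ⟨e.symm ≪≫ₗ Submodule.quotEquivOfEq _ _ heq⟩

lemma MemAdd.exists_hom_ne_zero {ι : Type*} {P : ι → ModuleCat.{u} A} {X Y : ModuleCat.{u} A}
    (hY : MemAdd P Y) {f : Y →ₗ[A] X} (hf : f ≠ 0) : ∃ (i : ι) (g : P i →ₗ[A] X), g ≠ 0 := by
  by_contra! hP
  refine hf (AddSubgroup.mem_bot.1 (mapsThrough_le (fun i a b => ?_)
    (hY.comp_mem_mapsThrough LinearMap.id f)))
  rw [hP i b, LinearMap.zero_comp]
  exact zero_mem _

lemma K0.rank_le_card [IsArtinianRing A] {ι : Type} [Fintype ι] {P : ι → ModuleCat.{u} A}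
    (hP : IsRepresentativeSet P) (hA : MemAdd P (ModuleCat.of A A)) :
    Module.rank ℤ (K0 A) ≤ Fintype.card ι := by
  have := hP.finite
  have := hP.projective
  have hmax (i : ι) : ∃ N : Submodule A (P i), IsCoatom N :=
    have := nontrivial_of_indecomposable (hP.indecomposable i)
    IsCoatomic.exists_coatom _
  choose N hN using hmax
  let S (i : ι) : FGMod A :=
    ⟨ModuleCat.of A (P i ⧸ N i), inferInstanceAs (Module.Finite A (P i ⧸ N i))⟩
  have hS : Submodule.span ℤ (Set.range fun i => K0.mk (S i)) = ⊤ := by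
    refine span_range_mk_of_simple fun X hX => ?_
    have := IsSimpleModule.nontrivial A X
    obtain ⟨x, hx⟩ := exists_ne (0 : X)
    obtain ⟨i, f, hf⟩ := hA.exists_hom_ne_zero (f := LinearMap.toSpanSingleton A X x) fun h =>
      hx (by rw [← one_smul A x, ← LinearMap.toSpanSingleton_apply, h, LinearMap.zero_apply])
    have := isLocalRing_end_of_indecomposable (hP.indecomposable i)
    exact ⟨i, nonempty_equiv_quotient_of_isCoatom (hN i) hf⟩
  rw [← rank_top, ← hS]
  refine (rank_span_le _).trans ?_
  simpa using Cardinal.mk_range_le_lift (f := fun i => K0.mk (S i))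

end GrothendieckGroup

lemma linearIndependent_of_triangular {k V ι : Type*} [CommRing k] [IsDomain k] [AddCommGroup V]
    [Module k V] [Finite ι] [LinearOrder ι] (v : ι → V) (l : ι → V →ₗ[k] k)
    (h0 : ∀ i j, j < i → l i (v j) = 0) (h1 : ∀ i, l i (v i) ≠ 0) : LinearIndependent k v := by
  have := Fintype.ofFinite ι
  let a : Matrix ι ι k := .of fun i j => l i (v j)
  have ha : a.IsUpperTriangular := fun i j hij => h0 i j hij
  have hdet : a.det ≠ 0 := by
    rw [Matrix.det_of_isUpperTriangular ha]
    exact Finset.prod_ne_zero_iff.2 fun i _ => h1 i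
  exact .of_comp (LinearMap.pi l) (Matrix.linearIndependent_cols_of_det_ne_zero hdet)

namespace IsExtProjectiveStratifyingSystem

variable {Λ : Type u} [Ring Λ] {ι : Type} [LinearOrder ι] {Θ Q : ι → ModuleCat.{u} Λ}

lemma card_le_rank_K0 [Fintype ι] (h : IsExtProjectiveStratifyingSystem Θ Q) (R : Type w)
    [CommRing R] [IsArtinianRing R] [Algebra R Λ] [Module.Finite R Λ] :
    (Fintype.card ι : Cardinal) ≤ Module.rank ℤ (K0 (EndOp (finSum Q))) := by
  have := h.finite_Q
  have := h.finite_theta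
  let := endOpAlgebra (finSum Q) R
  have := finite_endOp R (finSum Q)
  let v (j : ι) : K0 (EndOp (finSum Q)) :=
    K0.mk ⟨(homFunctor (finSum Q)).obj (Θ j), finite_homFunctor_obj R _ _⟩
  choose l hl using fun i => K0.exists_addMonoidHom_eq_zero_iff R (homProjective Q i)
  have hv : LinearIndependent ℤ v := by
    refine linearIndependent_of_triangular v (fun i => (l i).toIntLinearMap) (fun i j hij => ?_)
      fun i => ?_
    · exact (hl i _).2 (subsingleton_of_forall_eq 0 (h.hom_homProjective_theta_eq_zero hij))
    · refine mt (hl i _).1 fun hsub => ?_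
      obtain ⟨φ, hφ⟩ := h.exists_hom_Q_theta_ne_zero i
      exact hφ ((h.mapHom_bijective (h.filtered_Q i) (Θ i)).injective (hsub.elim _ _))
  simpa using hv.cardinal_lift_le_rank

lemma rank_K0 [Fintype ι] (h : IsExtProjectiveStratifyingSystem Θ Q) (R : Type w)
    [CommRing R] [IsArtinianRing R] [Algebra R Λ] [Module.Finite R Λ] :
    Module.rank ℤ (K0 (EndOp (finSum Q))) = Fintype.card ι := by
  have := h.finite_Q
  have := isArtinianRing_endOp R (finSum Q)
  exact le_antisymm (K0.rank_le_card h.isRepresentativeSet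
    (memAdd_homProjective_of_projective (Q := Q) (ModuleCat.of _ (EndOp (finSum Q)))))
    (h.card_le_rank_K0 R)

end IsExtProjectiveStratifyingSystem

end StratSys

end

theorem mainTheorem4 {R : Type w} [CommRing R] [IsArtinianRing R]
    {Λ : Type u} [Ring Λ] [Algebra R Λ] [Module.Finite R Λ]
    {ι : Type} [Fintype ι] [LinearOrder ι] (Θ Q : ι → ModuleCat.{u} Λ)
    (hΘ : IsExtProjectiveStratifyingSystem Θ Q) :
    let T : ModuleCat.{u} Λ := finSum Q
    let F : ModuleCat.{u} Λ ⥤ ModuleCat.{u} (EndOp T) := homFunctor T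
    let G : ModuleCat.{u} (EndOp T) ⥤ ModuleCat.{u} Λ := tensorFunctor T
    let P : ι → ModuleCat.{u} (EndOp T) := fun i => F.obj (Q i)
    let Δ : ι → ModuleCat.{u} (EndOp T) := standardModule P
    -- `Γ = End(⨁ Q(i))ᵒᵖ` is an artin `R`-algebra, `F` and `G` preserve finite generation
    (@Module.Finite R (EndOp T) _ _ (endOpAlgebra T R).toModule ∧
      (∀ X : ModuleCat.{u} Λ, Module.Finite Λ X → Module.Finite (EndOp T) (F.obj X)) ∧
      (∀ Y : ModuleCat.{u} (EndOp T), Module.Finite (EndOp T) Y →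
        Module.Finite Λ (G.obj Y))) ∧
    -- (a)
    (IsRepresentativeSet P ∧ IsBasic (EndOp T) ∧
      Module.rank ℤ (K0 (EndOp T)) = Fintype.card ι) ∧
    -- (b)
    IsStandardlyStratified P ∧
    -- (c)
    ((∀ S : ShortComplex (ModuleCat.{u} Λ), Filtered Θ S.X₁ → Filtered Θ S.X₂ →
        Filtered Θ S.X₃ → S.ShortExact → (S.map F).ShortExact) ∧
      ∃ (hF : ∀ X : (Filtered Θ).FullSubcategory, Filtered Δ (F.obj X.obj))
        (hG : ∀ Y : (Filtered Δ).FullSubcategory, Filtered Θ (G.obj Y.obj))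
        (e : (Filtered Θ).FullSubcategory ≌ (Filtered Δ).FullSubcategory),
        e.functor = (Filtered Δ).lift ((Filtered Θ).ι ⋙ F) hF ∧
        e.inverse = (Filtered Θ).lift ((Filtered Δ).ι ⋙ G) hG) ∧
    -- (d)
    (∀ i, Nonempty (F.obj (Θ i) ≅ Δ i)) ∧
    -- (e)
    AddClosure T = Filtered Θ ⊓ LeftPerpOne (Filtered Θ) := by
  intro T F G P Δ
  have := hΘ.finite_Q
  have : IsArtinianRing Λ := .of_finite R Λ
  have : IsArtinianRing (EndOp (finSum Q)) := isArtinianRing_endOp R (finSum Q)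
  exact ⟨⟨finite_endOp R (finSum Q), fun X _ => finite_homFunctor_obj R (finSum Q) X,
      fun Y _ => finite_tensorFunctor_obj (finSum Q) Y⟩,
    ⟨hΘ.isRepresentativeSet, hΘ.isBasic, hΘ.rank_K0 R⟩,
    hΘ.isStandardlyStratified,
    ⟨fun _ h₁ _ _ hS => hΘ.shortExact_map_homFunctor hS h₁, hΘ.exists_equivalence⟩,
    fun i => (hΘ.nonempty_equiv_standardModule i).map LinearEquiv.toModuleIso,
    hΘ.addClosure_finSum_eq⟩
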